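/- Let $d,K^*\in\mathbb N$, let $\Theta\subset\mathbb R^d$ be compact, $\theta^*_1,\dots,\theta^*_{K^*}\in\Theta$, and let $f:\mathbb N_0^{\mathbb N}\times\Theta\to[0,\infty)$ be such that $y\mapsto f(y;\theta)$ is measurable for every $\theta\in\Theta$. On one probability space, for each $j=1,\dots,K^*$, let $\{Y_{t,j},\,t\in\mathbb Z\}$ be a stationary and ergodic $\mathbb N_0$-valued process (no assumption is made on the joint law of the $K^*$ processes) with $$\mathbb E(Y_{t,j}\mid \mathcal F_{t-1,j})=\lambda_{t,j}(\theta^*_j)\ \text{ for all } t\in\mathbb Z,\qquad \lambda_{t,j}(\theta):=f(Y_{t-1,j},Y_{t-2,j},\dots;\theta),\qquad \mathcal F_{t,j}=\sigma(Y_{s,j},\,s\le t),$$ and such that, for some $C>0$ and $\epsilon>1$, $\mathbb E\,Y_{t,j}^{1+\epsilon}<C$ for all $t\in\mathbb Z$. Let $0=\tau^*_0<\tau^*_1<\dots<\tau^*_{K^*-1}<\tau^*_{K^*}=1$. For a sample size $n$, the break dates are $t^*_j=[n\tau^*_j]$ for $1\le j\le K^*-1$ (integer part), the true segments are $T^*_j=\{[n\tau^*_{j-1}]+1,\dots,[n\tau^*_j]\}$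 for $1\le j\le K^*$ (so they partition $\{1,\dots,n\}$), and the observations $Y_1,\dots,Y_n$ are given by $Y_t=Y_{t,j}$ for $t\in T^*_j$. For $t\in\{1,\dots,n\}$, $\theta\in\Theta$ and $T\subset\{1,\dots,n\}$ put $$\widehat\lambda_t(\theta)=f(Y_{t-1},\dots,Y_1,0,0,\dots;\theta),\qquad \widehat L_n(T,\theta)=\sum_{t\in T}\big(Y_t\log\widehat\lambda_t(\theta)-\widehat\lambda_t(\theta)\big).$$ A Poisson quasi-maximum likelihood estimator on $T$ is any maximizer $\widehat\theta_n(T)\in\operatorname{argmax}_{\theta\in\Theta}\widehat L_n(T,\theta)$. Assume the following. * $\mathbf A_0(\Theta)$: for every $y\in\mathbb N_0^{\mathbb N}$ the map $\theta\mapsto f(y;\theta)$ is continuous on $\Theta$, and there are $\alpha_k\ge0$, $k\ge1$, with $\sum_{k\ge1}\alpha_k<1$ and $\sup_{\theta\in\Theta}|f(y;\theta)-f(y';\theta)|\le\sum_{k\ge1}\alpha_k|y_k-y'_k|$ (possibly $+\infty$) for all $y,y'\in\mathbb N_0^{\mathbb N}$. * (A0): for each $j$ and all $\theta,\theta'\in\Theta$,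 if $\lambda_{t,j}(\theta)=\lambda_{t,j}(\theta')$ a.s. for some $t\in\mathbb N$, then $\theta=\theta'$; moreover there is $\underline c>0$ with $f(y;\theta)\ge\underline c$ for all $y\in\mathbb N_0^{\mathbb N}$ and $\theta\in\Theta$. * (A1): for each $j$, $\theta^*_j$ is an interior point of $\Theta$. * (A2): for each $j$ and each $n$, almost surely $a_{t,j}\to0$ and $Y_{t,j}\,a_{t,j}\to0$ as $t\to\infty$, where $$a_{t,j}=\sup_{\theta\in\Theta}\big|f(Y_{t-1,j},\dots,Y_{t^*_{j-1}+1,j},0,0,\dots;\theta)-\lambda_{t,j}(\theta)\big|,$$ with the convention $t^*_0=-\infty$ (no truncation for $j=1$). Then, for every $n$ and every $j=1,\dots,K^*$, a maximizer of $\theta\mapsto\widehat L_n(T^*_j,\theta)$ over $\Theta$ exists (for every realization of the observations); and for every $j=1,\dots,K^*$ and every sequence $\widehat\theta_n(T^*_j)$ such that, for each $n$, $\widehat\theta_n(T^*_j)$ is almost surely such a maximizer, $$\widehat\theta_n(T^*_j)\longrightarrow\theta^*_j\quad\text{almost surely as } n\to\infty .$$ -/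

import Mathlib

open MeasureTheory Filter Topology
open scoped ENNReal

namespace PQMLE

noncomputable section

/-- The parameter space `ℝ^d` with its Euclidean norm. -/
abbrev Param (d : ℕ) : Type := EuclideanSpace ℝ (Fin d)

/-- The infinite past `(Y_{t-1}, Y_{t-2}, …)` at time `t`; entry `k` is `Y_{t-1-k}`. -/
def past {Ω : Type*} (Y : ℤ → Ω → ℕ) (t : ℤ) (ω : Ω) : ℕ → ℕ :=
  fun k => Y (t - 1 - k) ω

/-- The truncated past `(Y_{t-1}, …, Y_{s+1}, 0, 0, …)`; for `s = ⊥` (that is, `s = -∞`) nothing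
is truncated. -/
def truncPast {Ω : Type*} (s : WithBot ℤ) (Y : ℤ → Ω → ℕ) (t : ℤ) (ω : Ω) : ℕ → ℕ :=
  fun k => if s < ((t - 1 - k : ℤ) : WithBot ℤ) then Y (t - 1 - k) ω else 0

/-- The σ-field generated by `Y_s`, `s ≤ t`. -/
abbrev pastField {Ω : Type*} (Y : ℤ → Ω → ℕ) (t : ℤ) : MeasurableSpace Ω :=
  ⨆ s : {s : ℤ // s ≤ t}, MeasurableSpace.comap (Y s) inferInstance

/-- Strict stationarity and ergodicity: the law of the process on the path space `ℕ^ℤ` is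
invariant and ergodic for the shift. -/
def IsStationaryErgodic {Ω : Type*} [MeasurableSpace Ω] (μ : Measure Ω) (Y : ℤ → Ω → ℕ) : Prop :=
  Ergodic (fun (x : ℤ → ℕ) (t : ℤ) => x (t + 1)) (μ.map fun ω t => Y t ω)

/-- `Y` is a stationary and ergodic process with `E(Y_t | Y_s, s < t) = f(Y_{t-1}, Y_{t-2}, …; θ)`
for all `t` and a uniformly bounded moment of some order `1 + ε > 2`. -/
structure IsRegime {Ω : Type*} [MeasurableSpace Ω] (μ : Measure Ω) {d : ℕ}
    (f : (ℕ → ℕ) → Param d → ℝ) (θ : Param d) (Y : ℤ → Ω → ℕ) : Prop where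
  measurable : ∀ t, Measurable (Y t)
  stationary_ergodic : IsStationaryErgodic μ Y
  condMean : ∀ t : ℤ,
    μ[fun ω => (Y t ω : ℝ) | pastField Y (t - 1)] =ᵐ[μ] fun ω => f (past Y t ω) θ
  moment : ∃ C : ℝ, 0 < C ∧ ∃ ε : ℝ, 1 < ε ∧
    ∀ t : ℤ, ∫⁻ ω, (Y t ω : ℝ≥0∞) ^ (1 + ε) ∂μ < ENNReal.ofReal C

/-- The Lipschitz-type condition of order `0` on `f`: continuity in the parameter, and a Lipschitz
bound in the past whose coefficients have sum less than one. Here `α k` is the coefficient of the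
lag `k + 1`; the right-hand side of the bound may be infinite. -/
def LipschitzA0 {d : ℕ} (f : (ℕ → ℕ) → Param d → ℝ) (Θ : Set (Param d)) : Prop :=
  (∀ y, ContinuousOn (f y) Θ) ∧
  ∃ α : ℕ → ℝ, (∀ k, 0 ≤ α k) ∧ Summable α ∧ ∑' k, α k < 1 ∧
    ∀ y y' : ℕ → ℕ, ⨆ θ ∈ Θ, ENNReal.ofReal |f y θ - f y' θ| ≤
      ∑' k, ENNReal.ofReal (α k * |(y k : ℝ) - (y' k : ℝ)|)

/-- Identifiability of the parameter in each regime, and a positive lower bound for `f`. -/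
def CondA0 {Ω : Type*} [MeasurableSpace Ω] (μ : Measure Ω) {d K : ℕ}
    (f : (ℕ → ℕ) → Param d → ℝ) (Θ : Set (Param d)) (Y : Fin K → ℤ → Ω → ℕ) : Prop :=
  (∀ j : Fin K, ∀ θ ∈ Θ, ∀ θ' ∈ Θ,
    (∃ t : ℕ, ∀ᵐ ω ∂μ, f (past (Y j) t ω) θ = f (past (Y j) t ω) θ') → θ = θ') ∧
  ∃ c : ℝ, 0 < c ∧ ∀ y, ∀ θ ∈ Θ, c ≤ f y θ

/-- The instant `[n τ_i]`, `i = 0, …, K`; it is `0` for `τ_0 = 0` and `n` for `τ_K = 1`. -/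
def breakDate {K : ℕ} (τ : Fin (K + 1) → ℝ) (n : ℕ) (i : Fin (K + 1)) : ℤ := ⌊(n : ℝ) * τ i⌋

/-- The true segment number `j`, `{[n τ_{j-1}] + 1, …, [n τ_j]}`. Regimes are indexed from `0`
in `Fin K`, so that `j.castSucc` and `j.succ` are its two end points. -/
def trueSegment {K : ℕ} (τ : Fin (K + 1) → ℝ) (n : ℕ) (j : Fin K) : Finset ℤ :=
  Finset.Ioc (breakDate τ n j.castSucc) (breakDate τ n j.succ)

/-- The last instant before the regime `j` becomes active, with the convention `-∞` for the
first regime. -/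
def regimeStart {K : ℕ} (τ : Fin (K + 1) → ℝ) (n : ℕ) (j : Fin K) : WithBot ℤ :=
  if (j : ℕ) = 0 then ⊥ else ((breakDate τ n j.castSucc : ℤ) : WithBot ℤ)

/-- `a_{t,j} = sup_{θ ∈ Θ} |f(Y_{t-1,j}, …, Y_{s+1,j}, 0, …; θ) - f(Y_{t-1,j}, Y_{t-2,j}, …; θ)|`,
for one regime `Y_{·,j}` started after the instant `s`. -/
def truncError {Ω : Type*} {d : ℕ} (f : (ℕ → ℕ) → Param d → ℝ) (Θ : Set (Param d))
    (s : WithBot ℤ) (Y : ℤ → Ω → ℕ) (t : ℤ) (ω : Ω) : ℝ≥0∞ :=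
  ⨆ θ ∈ Θ, ENNReal.ofReal |f (truncPast s Y t ω) θ - f (past Y t ω) θ|

/-- For each regime, `a_{t,j} → 0` and `Y_{t,j} a_{t,j} → 0` almost surely as `t → ∞`. -/
def CondA2 {Ω : Type*} [MeasurableSpace Ω] (μ : Measure Ω) {d K : ℕ}
    (f : (ℕ → ℕ) → Param d → ℝ) (Θ : Set (Param d)) (τ : Fin (K + 1) → ℝ)
    (Y : Fin K → ℤ → Ω → ℕ) : Prop :=
  ∀ (n : ℕ) (j : Fin K), ∀ᵐ ω ∂μ,
    Tendsto (fun t : ℤ => truncError f Θ (regimeStart τ n j) (Y j) t ω) atTop (𝓝 0) ∧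
    Tendsto (fun t : ℤ => (Y j t ω : ℝ≥0∞) * truncError f Θ (regimeStart τ n j) (Y j) t ω)
      atTop (𝓝 0)

/-- The observations `Y_1, …, Y_n` at sample size `n`: `Y_t = Y_{t,j}` for `t` in the segment `j`
(and, irrelevantly, `0` for `t` outside `{1, …, n}`). -/
def observed {Ω : Type*} {K : ℕ} (τ : Fin (K + 1) → ℝ) (Y : Fin K → ℤ → Ω → ℕ) (n : ℕ) :
    ℤ → Ω → ℕ :=
  fun t ω => ∑ j, if t ∈ trueSegment τ n j then Y j t ω else 0

/-- `f(X_{t-1}, …, X_1, 0, …; θ)`. -/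
def condMeanHat {Ω : Type*} {d : ℕ} (f : (ℕ → ℕ) → Param d → ℝ) (X : ℤ → Ω → ℕ) (t : ℤ)
    (θ : Param d) (ω : Ω) : ℝ :=
  f (truncPast ((0 : ℤ) : WithBot ℤ) X t ω) θ

/-- The conditional Poisson quasi-log-likelihood of the observations `X` on a set `T` of times. -/
def quasiLogLik {Ω : Type*} {d : ℕ} (f : (ℕ → ℕ) → Param d → ℝ) (X : ℤ → Ω → ℕ) (T : Finset ℤ)
    (θ : Param d) (ω : Ω) : ℝ :=
  ∑ t ∈ T, ((X t ω : ℝ) * Real.log (condMeanHat f X t θ ω) - condMeanHat f X t θ ω)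

/-- The set of Poisson quasi-maximum likelihood estimates on `T`: the maximizers over `Θ` of the
quasi-log-likelihood. -/
def argmaxQL {Ω : Type*} {d : ℕ} (f : (ℕ → ℕ) → Param d → ℝ) (Θ : Set (Param d))
    (X : ℤ → Ω → ℕ) (T : Finset ℤ) (ω : Ω) : Set (Param d) :=
  {θ | θ ∈ Θ ∧ IsMaxOn (fun θ' => quasiLogLik f X T θ' ω) Θ θ}

end

end PQMLE

/-!
# Consistency of the Poisson quasi-maximum likelihood estimator on a true segment

Compare, on the segment of regime `j`, the quasi-likelihood of the observations with the sum of the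
contributions `contrib f θ` that use the whole past of the regime itself. The two pasts agree up to
the start of the segment, so the difference at time `t` is at most a multiple of
`(1 + Y_t) ∑_{k ≥ m} α_k ∑_i Y_{t-1-k,i}`, where `m` is the number of earlier instants of the segment
and `i` runs through all the regimes. Since `z ≤ z²` on the natural numbers and
`2 a z ≤ a² + z²`, this is below a sum of functionals of one regime each (`tsum_dist_le_errBound`),
integrable because second moments are finite. The ergodic theorem for each regime, and
`∑_{k ≥ m} α_k → 0`, show that the average of these errors over the segment tends to `0`
(`tendsto_sum_Ioc_diag`, `ae_tendsto_errBound`). Neither the joint law of the regimes nor a rate of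
decay of the coefficients `α_k` matters.

The stationary criterion is then handled by Wald's method. Its limit `E contrib f θ` has a strict
maximum at the true parameter: conditioning on the past replaces `Y_t` by the true conditional mean
`u`, and `v ↦ u log v - v` has its only maximum at `u`, so that identifiability applies
(`integral_contrib_lt`). Near any other parameter the contributions are dominated by a function of
smaller mean (`exists_local_majorant`), whence almost surely no maximizer lies there eventually
(`ae_eventually_not_mem_argmaxQL`); compactness of the parameter set finishes the proof.

The pointwise ergodic theorem is obtained from the fact that the Birkhoff sums of a function with
negative integral are almost surely bounded above (`ae_bddAbove_birkhoffSum`).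
-/

namespace PQMLE

/-! ### The pointwise ergodic theorem -/

section Ergodic

variable {X : Type*}

/-- The largest of the Birkhoff sums of `h` of length at most `n`, and of `0`. It is defined by the
recursion `M (n + 1) = max 0 (h + M n ∘ T)` on which the maximal ergodic argument rests. -/
noncomputable def maxBirkhoff (T : X → X) (h : X → ℝ) : ℕ → X → ℝ
  | 0, _ => 0
  | n + 1, x => max 0 (h x + maxBirkhoff T h n (T x))

lemma maxBirkhoff_nonneg (T : X → X) (h : X → ℝ) (n : ℕ) (x : X) : 0 ≤ maxBirkhoff T h n x := by
  cases n <;> simp [maxBirkhoff]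

lemma birkhoffSum_le_maxBirkhoff (T : X → X) (h : X → ℝ) (n : ℕ) (x : X) :
    birkhoffSum T h n x ≤ maxBirkhoff T h n x := by
  induction n generalizing x with
  | zero => simp [maxBirkhoff]
  | succ n ih =>
    rw [birkhoffSum_succ']
    exact (add_le_add_right (ih (T x)) (h x)).trans (le_max_right _ _)

lemma maxBirkhoff_le_succ (T : X → X) (h : X → ℝ) (n : ℕ) (x : X) :
    maxBirkhoff T h n x ≤ maxBirkhoff T h (n + 1) x := by
  induction n generalizing x with
  | zero => simp [maxBirkhoff]
  | succ n ih => exact max_le_max le_rfl (add_le_add_right (ih (T x)) (h x))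

lemma monotone_maxBirkhoff (T : X → X) (h : X → ℝ) (x : X) :
    Monotone fun n => maxBirkhoff T h n x :=
  monotone_nat_of_le_succ fun n => maxBirkhoff_le_succ T h n x

variable [MeasurableSpace X]

lemma measurable_maxBirkhoff {T : X → X} (hT : Measurable T) {h : X → ℝ} (hh : Measurable h)
    (n : ℕ) : Measurable (maxBirkhoff T h n) := by
  induction n with
  | zero => exact measurable_const
  | succ n ih => exact measurable_const.max (hh.add (ih.comp hT))

lemma integrable_maxBirkhoff {ν : Measure X} {T : X → X} (hT : MeasurePreserving T ν ν)
    {h : X → ℝ} (hi : Integrable h ν) (n : ℕ) : Integrable (maxBirkhoff T h n) ν := by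
  induction n with
  | zero => exact integrable_zero X ℝ ν
  | succ n ih =>
    exact (integrable_zero X ℝ ν).sup (hi.add (hT.integrable_comp_of_integrable ih))

/-- For an ergodic map, the Birkhoff sums of a function with negative integral are almost surely
bounded above. Otherwise, by ergodicity, `maxBirkhoff T h n` tends to infinity almost everywhere, so
that `M (n + 1) - M n ∘ T = max (- M n ∘ T) h` tends to `h`, although its integral, which is that
of `M (n + 1) - M n`, is nonnegative. -/
lemma ae_bddAbove_birkhoffSum {ν : Measure X} [IsProbabilityMeasure ν] {T : X → X}
    (hT : Ergodic T ν) {h : X → ℝ} (hh : Measurable h) (hi : Integrable h ν)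
    (hneg : ∫ x, h x ∂ν < 0) : ∀ᵐ x ∂ν, ∃ C : ℝ, ∀ n, birkhoffSum T h n x ≤ C := by
  set M := maxBirkhoff T h with hM
  set A : Set X := {x | BddAbove (Set.range fun n => M n x)} with hA
  have hAm : MeasurableSet A := measurableSet_bddAbove_range fun n =>
    measurable_maxBirkhoff hT.measurable hh n
  have hinv : T ⁻¹' A = A := by
    ext x
    simp only [hA, Set.mem_preimage, Set.mem_ofPred_eq]
    constructor
    · rintro ⟨C, hC⟩
      refine ⟨max 0 (h x + C), ?_⟩
      rintro _ ⟨n, rfl⟩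
      refine (maxBirkhoff_le_succ T h n x).trans ?_
      exact max_le_max le_rfl (add_le_add_right (hC ⟨n, rfl⟩) _)
    · rintro ⟨C, hC⟩
      refine ⟨C - h x, ?_⟩
      rintro _ ⟨n, rfl⟩
      have h1 : M (n + 1) x ≤ C := hC ⟨n + 1, rfl⟩
      have h2 : h x + M n (T x) ≤ M (n + 1) x := le_max_right _ _
      change M n (T x) ≤ _
      linarith
  rcases hT.toPreErgodic.ae_mem_or_ae_notMem hAm hinv with hmem | hnot
  · filter_upwards [hmem] with x hx
    obtain ⟨C, hC⟩ := hx
    exact ⟨C, fun n => (birkhoffSum_le_maxBirkhoff T h n x).trans (hC ⟨n, rfl⟩)⟩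
  · exfalso
    have hMi := integrable_maxBirkhoff hT.toMeasurePreserving hi
    have hMT : ∀ n, Integrable (fun x => M n (T x)) ν := fun n =>
      hT.toMeasurePreserving.integrable_comp_of_integrable (hMi n)
    have hnonneg : ∀ n, 0 ≤ ∫ x, (M (n + 1) x - M n (T x)) ∂ν := by
      intro n
      have hcomp : ∫ x, M n (T x) ∂ν = ∫ x, M n x ∂ν := by
        have := integral_map (μ := ν) hT.measurable.aemeasurable
          (f := M n) (measurable_maxBirkhoff hT.measurable hh n).aestronglyMeasurable
        rw [hT.map_eq] at this
        exact this.symm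
      rw [integral_sub (hMi (n + 1)) (hMT n), hcomp, sub_nonneg]
      exact integral_mono (hMi n) (hMi (n + 1)) fun x => maxBirkhoff_le_succ T h n x
    have hform : ∀ n x, M (n + 1) x - M n (T x) = max (-M n (T x)) (h x) := by
      intro n x
      change max 0 (h x + M n (T x)) - M n (T x) = _
      rw [← max_sub_sub_right]
      congr 1 <;> ring
    have hlim : Tendsto (fun n => ∫ x, (M (n + 1) x - M n (T x)) ∂ν) atTop (𝓝 (∫ x, h x ∂ν)) := by
      refine tendsto_integral_of_dominated_convergence (fun x => |h x|)
        (fun n => ((hMi (n + 1)).sub (hMT n)).aestronglyMeasurable) hi.abs ?_ ?_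
      · refine fun n => Eventually.of_forall fun x => ?_
        have h0 : 0 ≤ M n (T x) := maxBirkhoff_nonneg T h n (T x)
        rw [hform, Real.norm_eq_abs, abs_le]
        exact ⟨(neg_abs_le _).trans (le_max_right _ _),
          max_le (by linarith [abs_nonneg (h x)]) (le_abs_self _)⟩
      · filter_upwards [hnot] with x hx
        have hTx : T x ∉ A := fun hc => hx (by rw [← hinv]; exact hc)
        have htop : Tendsto (fun n => M n (T x)) atTop atTop :=
          (tendsto_atTop_of_monotone (monotone_maxBirkhoff T h (T x))).resolve_right (by
            rintro ⟨l, hl⟩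
            exact hTx hl.bddAbove_range)
        refine tendsto_const_nhds.congr' ?_
        filter_upwards [htop.eventually_ge_atTop (-h x)] with n hn
        rw [hform, max_eq_right (by linarith)]
    exact absurd (ge_of_tendsto' hlim hnonneg) (not_le.2 hneg)

lemma ae_limsup_birkhoff_le {ν : Measure X} [IsProbabilityMeasure ν] {T : X → X}
    (hT : Ergodic T ν) {h : X → ℝ} (hh : Measurable h) (hi : Integrable h ν) :
    ∀ᵐ x ∂ν, ∀ ε > 0, ∀ᶠ n : ℕ in atTop,
      birkhoffSum T h n x / n ≤ (∫ x, h x ∂ν) + ε := by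
  have key : ∀ m : ℕ, ∀ᵐ x ∂ν, ∃ C : ℝ, ∀ n,
      birkhoffSum T (fun x => h x - ((∫ x, h x ∂ν) + 1 / ((m : ℝ) + 1))) n x ≤ C := by
    intro m
    refine ae_bddAbove_birkhoffSum hT (hh.sub measurable_const)
      (hi.sub (integrable_const _)) ?_
    rw [integral_sub hi (integrable_const _)]
    simp
    positivity
  filter_upwards [ae_all_iff.2 key] with x hx ε hε
  obtain ⟨m, hm⟩ := exists_nat_one_div_lt (half_pos hε)
  obtain ⟨C, hC⟩ := hx m
  have hlim : Tendsto (fun n : ℕ => C / (n : ℝ)) atTop (𝓝 0) :=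
    tendsto_const_div_atTop_nhds_zero_nat C
  filter_upwards [hlim.eventually_lt_const (half_pos hε), eventually_gt_atTop 0] with n hn hn0
  have hn0' : (0 : ℝ) < n := by exact_mod_cast hn0
  have hCn := hC n
  simp only [birkhoffSum, Finset.sum_sub_distrib, Finset.sum_const, Finset.card_range,
    nsmul_eq_mul] at hCn ⊢
  rw [div_lt_iff₀ hn0'] at hn
  rw [div_le_iff₀ hn0']
  nlinarith

/-- Birkhoff's pointwise ergodic theorem, for an ergodic map. -/
theorem ae_tendsto_birkhoff {ν : Measure X} [IsProbabilityMeasure ν] {T : X → X}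
    (hT : Ergodic T ν) {h : X → ℝ} (hh : Measurable h) (hi : Integrable h ν) :
    ∀ᵐ x ∂ν, Tendsto (fun n : ℕ => (∑ t ∈ Finset.range n, h (T^[t] x)) / n) atTop
      (𝓝 (∫ x, h x ∂ν)) := by
  filter_upwards [ae_limsup_birkhoff_le hT hh hi, ae_limsup_birkhoff_le hT hh.neg hi.neg]
    with x h1 h2
  rw [Metric.tendsto_nhds]
  intro ε hε
  filter_upwards [h1 (ε / 2) (half_pos hε), h2 (ε / 2) (half_pos hε)] with n hn1 hn2
  simp only [birkhoffSum, Pi.neg_apply, Finset.sum_neg_distrib, integral_neg, neg_div] at hn1 hn2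
  rw [Real.dist_eq, abs_lt]
  constructor <;> linarith

end Ergodic

/-! ### Averages over windows -/

/-- If the averages of `a` converge to `A`, and `p n ∼ c n`, then the sums over `t < p n`, divided by
`n`, converge to `c A`; here `c = 0` is allowed, and `p n` need not tend to infinity. -/
lemma tendsto_sum_range_div {a : ℕ → ℝ} {A : ℝ}
    (ha : Tendsto (fun n : ℕ => (∑ t ∈ Finset.range n, a t) / n) atTop (𝓝 A))
    {p : ℕ → ℕ} {c : ℝ} (hp : Tendsto (fun n : ℕ => (p n : ℝ) / n) atTop (𝓝 c)) :
    Tendsto (fun n : ℕ => (∑ t ∈ Finset.range (p n), a t) / n) atTop (𝓝 (c * A)) := by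
  have hbound : ∀ ε > 0, ∃ C, ∀ m : ℕ, |∑ t ∈ Finset.range m, a t - m * A| ≤ ε * m + C := by
    intro ε hε
    obtain ⟨N, hN⟩ := (Metric.tendsto_atTop.1 ha) ε hε
    refine ⟨∑ m ∈ Finset.range (N + 1), |∑ t ∈ Finset.range m, a t - m * A|, fun m => ?_⟩
    rcases Nat.lt_or_ge m (N + 1) with hm | hm
    · have := Finset.single_le_sum (f := fun m : ℕ => |∑ t ∈ Finset.range m, a t - m * A|)
        (fun i _ => abs_nonneg _) (Finset.mem_range.2 hm)
      have h0 : 0 ≤ ε * m := by positivity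
      linarith
    · have hm0 : (0 : ℝ) < m := by exact_mod_cast (by omega : 0 < m)
      have h1 := (hN m (by omega)).le
      rw [Real.dist_eq, div_sub' hm0.ne', abs_div, abs_of_pos hm0, div_le_iff₀ hm0] at h1
      have h2 : 0 ≤ ∑ m ∈ Finset.range (N + 1), |∑ t ∈ Finset.range m, a t - m * A| :=
        Finset.sum_nonneg fun i _ => abs_nonneg _
      linarith
  have hdiff : Tendsto (fun n : ℕ => (∑ t ∈ Finset.range (p n), a t) / n - p n / n * A)
      atTop (𝓝 0) := by
    rw [Metric.tendsto_nhds]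
    intro ε hε
    have hc : 0 ≤ c := ge_of_tendsto' hp fun n => by positivity
    obtain ⟨C, hC⟩ := hbound (ε / 2 / (c + 1)) (by positivity)
    have hlim : Tendsto (fun n : ℕ => C / (n : ℝ)) atTop (𝓝 0) :=
      tendsto_const_div_atTop_nhds_zero_nat C
    filter_upwards [hlim.eventually_lt_const (half_pos hε), eventually_gt_atTop 0,
      hp.eventually_lt_const (lt_add_one c)] with n hn hn0 hpn
    have hn0' : (0 : ℝ) < n := by exact_mod_cast hn0
    have e : (∑ t ∈ Finset.range (p n), a t) / n - p n / n * A
        = (∑ t ∈ Finset.range (p n), a t - p n * A) / n := by ring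
    rw [Real.dist_eq, sub_zero, e, abs_div, abs_of_pos hn0']
    calc |∑ t ∈ Finset.range (p n), a t - p n * A| / n
        ≤ (ε / 2 / (c + 1) * p n + C) / n := by gcongr; exact hC _
      _ = ε / 2 / (c + 1) * (p n / n) + C / n := by ring
      _ < ε / 2 / (c + 1) * (c + 1) + ε / 2 := by gcongr
      _ = ε := by field_simp; ring
  simpa using hdiff.add (hp.mul_const A)

/-- A sum over the integer window `(s, e]`, as a difference of sums over initial segments. -/
lemma sum_Ioc_int (a : ℤ → ℝ) {s e : ℤ} (hs : 0 ≤ s) (hse : s ≤ e) :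
    ∑ t ∈ Finset.Ioc s e, a t =
      ∑ t ∈ Finset.range (e.toNat + 1), a t - ∑ t ∈ Finset.range (s.toNat + 1), a t := by
  rw [← Finset.sum_Ico_eq_sub _ (by omega)]
  symm
  refine Finset.sum_bij (fun t _ => (t : ℤ)) ?_ ?_ ?_ ?_
  · intro t ht
    simp only [Finset.mem_Ico, Finset.mem_Ioc] at ht ⊢
    omega
  · intro t _ t' _ h
    exact_mod_cast h
  · intro t ht
    simp only [Finset.mem_Ioc] at ht
    exact ⟨t.toNat, by simp only [Finset.mem_Ico]; omega, by omega⟩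
  · intro t _
    rfl

lemma tendsto_toNat_succ_div {u : ℕ → ℤ} {c : ℝ} (h0 : ∀ n, 0 ≤ u n)
    (hu : Tendsto (fun n : ℕ => (u n : ℝ) / n) atTop (𝓝 c)) :
    Tendsto (fun n : ℕ => (((u n).toNat + 1 : ℕ) : ℝ) / n) atTop (𝓝 c) := by
  have h1 : Tendsto (fun n : ℕ => (1 : ℝ) / n) atTop (𝓝 0) :=
    tendsto_const_div_atTop_nhds_zero_nat 1
  have h2 := hu.add h1
  rw [add_zero] at h2
  refine h2.congr fun n => ?_
  have : (((u n).toNat : ℕ) : ℝ) = (u n : ℝ) := by exact_mod_cast Int.toNat_of_nonneg (h0 n)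
  rw [Nat.cast_add, this, Nat.cast_one, add_div]

/-- Averages over windows `(s n, e n]` whose end points grow linearly. -/
lemma tendsto_sum_Ioc_div {a : ℤ → ℝ} {A : ℝ}
    (ha : Tendsto (fun n : ℕ => (∑ t ∈ Finset.range n, a t) / n) atTop (𝓝 A))
    {s e : ℕ → ℤ} {cs ce : ℝ} (h0 : ∀ n, 0 ≤ s n) (hse : ∀ n, s n ≤ e n)
    (hs : Tendsto (fun n : ℕ => (s n : ℝ) / n) atTop (𝓝 cs))
    (he : Tendsto (fun n : ℕ => (e n : ℝ) / n) atTop (𝓝 ce)) :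
    Tendsto (fun n : ℕ => (∑ t ∈ Finset.Ioc (s n) (e n), a t) / n) atTop
      (𝓝 ((ce - cs) * A)) := by
  have h1 := tendsto_sum_range_div ha (tendsto_toNat_succ_div h0 hs)
  have h2 := tendsto_sum_range_div ha
    (tendsto_toNat_succ_div (fun n => (h0 n).trans (hse n)) he)
  rw [sub_mul]
  refine (h2.sub h1).congr fun n => ?_
  rw [sum_Ioc_int a (h0 n) (hse n), sub_div]

/-- If `u m` decreases with `m` and has asymptotic mean `c m → 0`, then the average over a window
`(s, e]` of `u (t - 1 - s) t` tends to `0`: bound `u (t - 1 - s)` by `u 0` on the first `M` instants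
of the window, which do not count in the limit, and by `u M` afterwards. -/
lemma tendsto_sum_Ioc_diag {u : ℕ → ℤ → ℝ} {c : ℕ → ℝ} (hnn : ∀ m t, 0 ≤ u m t)
    (hanti : ∀ t, Antitone fun m => u m t)
    (hu : ∀ m, Tendsto (fun n : ℕ => (∑ t ∈ Finset.range n, u m t) / n) atTop (𝓝 (c m)))
    (hc : Tendsto c atTop (𝓝 0))
    {s e : ℕ → ℤ} {cs ce : ℝ} (h0 : ∀ n, 0 ≤ s n) (hse : ∀ n, s n ≤ e n)
    (hs : Tendsto (fun n : ℕ => (s n : ℝ) / n) atTop (𝓝 cs))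
    (he : Tendsto (fun n : ℕ => (e n : ℝ) / n) atTop (𝓝 ce)) :
    Tendsto (fun n : ℕ => (∑ t ∈ Finset.Ioc (s n) (e n), u (t - 1 - s n).toNat t) / n) atTop
      (𝓝 0) := by
  rw [Metric.tendsto_nhds]
  intro ε hε
  have hc' : Tendsto (fun m => (ce - cs) * c m) atTop (𝓝 0) := by
    simpa using hc.const_mul (ce - cs)
  obtain ⟨M, hM⟩ := (hc'.eventually_lt_const (half_pos hε)).exists
  have hsM : Tendsto (fun n : ℕ => ((s n + M : ℤ) : ℝ) / n) atTop (𝓝 cs) := by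
    have h1 : Tendsto (fun n : ℕ => (M : ℝ) / n) atTop (𝓝 0) :=
      tendsto_const_div_atTop_nhds_zero_nat _
    have h2 := hs.add h1
    rw [add_zero] at h2
    exact h2.congr fun n => by push_cast; rw [add_div]
  have l1 := tendsto_sum_Ioc_div (hu 0) (e := fun n => s n + M) h0 (fun n => by simp) hs hsM
  rw [sub_self, zero_mul] at l1
  have l2 := tendsto_sum_Ioc_div (hu M) h0 hse hs he
  filter_upwards [l1.eventually_lt_const (half_pos hε), l2.eventually_lt_const hM] with n hn1 hn2
  rw [Real.dist_eq, sub_zero, abs_of_nonneg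
    (div_nonneg (Finset.sum_nonneg fun t _ => hnn _ t) n.cast_nonneg)]
  have hle : ∑ t ∈ Finset.Ioc (s n) (e n), u (t - 1 - s n).toNat t ≤
      ∑ t ∈ Finset.Ioc (s n) (s n + M), u 0 t + ∑ t ∈ Finset.Ioc (s n) (e n), u M t := by
    calc ∑ t ∈ Finset.Ioc (s n) (e n), u (t - 1 - s n).toNat t
        ≤ ∑ t ∈ Finset.Ioc (s n) (e n), ((if t ≤ s n + M then u 0 t else 0) + u M t) := by
          refine Finset.sum_le_sum fun t ht => ?_
          have ht' := Finset.mem_Ioc.1 ht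
          split_ifs with h
          · have := hanti t (Nat.zero_le (t - 1 - s n).toNat)
            have h3 := hnn M t
            simp only at this
            linarith
          · have := hanti t (show M ≤ (t - 1 - s n).toNat by omega)
            simp only at this
            linarith
      _ = ∑ t ∈ Finset.Ioc (s n) (e n) with t ≤ s n + M, u 0 t +
            ∑ t ∈ Finset.Ioc (s n) (e n), u M t := by
          rw [Finset.sum_add_distrib, Finset.sum_filter]
      _ ≤ _ := by
          refine add_le_add_left (Finset.sum_le_sum_of_subset_of_nonneg ?_ fun t _ _ => hnn 0 t) _
          intro t ht
          simp only [Finset.mem_filter, Finset.mem_Ioc] at ht ⊢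
          omega
  calc _ ≤ (∑ t ∈ Finset.Ioc (s n) (s n + M), u 0 t + ∑ t ∈ Finset.Ioc (s n) (e n), u M t) / n := by
        gcongr
    _ = (∑ t ∈ Finset.Ioc (s n) (s n + M), u 0 t) / n
          + (∑ t ∈ Finset.Ioc (s n) (e n), u M t) / n := add_div _ _ _
    _ < ε := by linarith

/-! ### Weighted sums of squares of the past -/

/-- The tail `∑_{k ≥ m} α_k` of the Lipschitz coefficients. -/
noncomputable def tailCoef (α : ℕ → ℝ) (m : ℕ) : ℝ := ∑' k, α (k + m)

/-- The weighted sum of squares `∑_{k ≥ m} α_k x_{t-1-k}²` over the remote past at time `t`. As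
`x ≤ x²` on the natural numbers, it also controls `∑_{k ≥ m} α_k x_{t-1-k}`. Its value is `0` if the
series diverges, which happens with probability `0` only. -/
noncomputable def tailSq (α : ℕ → ℝ) (m : ℕ) (x : ℤ → ℕ) (t : ℤ) : ℝ :=
  ∑' k : ℕ, α (k + m) * (x (t - 1 - (k + m : ℕ)) : ℝ) ^ 2

section Deterministic

variable {α : ℕ → ℝ}

lemma tailCoef_nonneg (h0 : ∀ k, 0 ≤ α k) (m : ℕ) : 0 ≤ tailCoef α m :=
  tsum_nonneg fun _ => h0 _

lemma tailSq_nonneg (h0 : ∀ k, 0 ≤ α k) (m : ℕ) (x : ℤ → ℕ) (t : ℤ) : 0 ≤ tailSq α m x t :=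
  tsum_nonneg fun _ => mul_nonneg (h0 _) (sq_nonneg _)

lemma antitone_tsum_nat_add {b : ℕ → ℝ} (h0 : ∀ k, 0 ≤ b k) (hb : Summable b) :
    Antitone fun m => ∑' k, b (k + m) := by
  refine antitone_nat_of_succ_le fun m => ?_
  have h := ((summable_nat_add_iff m).2 hb).tsum_eq_zero_add
  rw [h]
  have : (fun k => b (k + 1 + m)) = fun k => b (k + (m + 1)) := by
    funext k; congr 1; ring
  rw [this]
  linarith [h0 (0 + m)]

lemma antitone_tailCoef (h0 : ∀ k, 0 ≤ α k) (hα : Summable α) : Antitone (tailCoef α) :=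
  antitone_tsum_nat_add h0 hα

lemma tendsto_tailCoef (α : ℕ → ℝ) : Tendsto (tailCoef α) atTop (𝓝 0) :=
  tendsto_sum_nat_add α

lemma antitone_tailSq (h0 : ∀ k, 0 ≤ α k) {x : ℤ → ℕ} {t : ℤ}
    (hx : Summable fun k : ℕ => α k * (x (t - 1 - k) : ℝ) ^ 2) :
    Antitone fun m => tailSq α m x t :=
  antitone_tsum_nat_add (b := fun k : ℕ => α k * (x (t - 1 - k) : ℝ) ^ 2)
    (fun k => mul_nonneg (h0 k) (sq_nonneg _)) hx

/-- A bound for `(1 + a_t) ∑_k α_k |y_k - y'_k|`, where the lags `y`, `y'` at time `t` agree up to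
lag `m` and lie below the sum of the paths `x i`. It is a sum of functionals of one path each, so
that its long-run average is given by the ergodic theorem for each path separately. -/
noncomputable def errBound {ι : Type*} [Fintype ι] (α : ℕ → ℝ) (x : ι → ℤ → ℕ) (a : ℤ → ℕ) (m : ℕ)
    (t : ℤ) : ℝ :=
  ∑ i, (tailCoef α m * (a t : ℝ) ^ 2 + 2 * tailSq α m (x i) t)

variable {ι : Type*} [Fintype ι]

lemma errBound_nonneg (h0 : ∀ k, 0 ≤ α k) (x : ι → ℤ → ℕ) (a : ℤ → ℕ) (m : ℕ) (t : ℤ) :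
    0 ≤ errBound α x a m t :=
  Finset.sum_nonneg fun _ _ => add_nonneg (mul_nonneg (tailCoef_nonneg h0 m) (sq_nonneg _))
    (mul_nonneg zero_le_two (tailSq_nonneg h0 m _ t))

lemma antitone_errBound (h0 : ∀ k, 0 ≤ α k) (hα : Summable α) {x : ι → ℤ → ℕ} (a : ℤ → ℕ) {t : ℤ}
    (hx : ∀ i, Summable fun k : ℕ => α k * (x i (t - 1 - k) : ℝ) ^ 2) :
    Antitone fun m => errBound α x a m t := by
  intro m m' h
  refine Finset.sum_le_sum fun i _ => ?_
  exact add_le_add (mul_le_mul_of_nonneg_right (antitone_tailCoef h0 hα h) (sq_nonneg _))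
    (mul_le_mul_of_nonneg_left (antitone_tailSq h0 (hx i) h) zero_le_two)

/-- Two sequences of lags that agree up to lag `m` and lie below the sum of the paths `x i` have
weighted distance controlled by `errBound`. The products `a z` that arise are split as
`(a² + z²) / 2`, so that no joint law of the paths matters later. -/
lemma tsum_dist_le_errBound (h0 : ∀ k, 0 ≤ α k) (hα : Summable α) {x : ι → ℤ → ℕ} (a : ℤ → ℕ)
    {t : ℤ} (hx : ∀ i, Summable fun k : ℕ => α k * (x i (t - 1 - k) : ℝ) ^ 2)
    {y y' : ℕ → ℕ} {m : ℕ} (hy : ∀ k, y k ≤ ∑ i, x i (t - 1 - k))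
    (hy' : ∀ k, y' k ≤ ∑ i, x i (t - 1 - k)) (hyy : ∀ k < m, y k = y' k) :
    (Summable fun k => α k * |(y k : ℝ) - y' k|) ∧
      (1 + (a t : ℝ)) * ∑' k, α k * |(y k : ℝ) - y' k| ≤ errBound α x a m t := by
  set D : ℕ → ℝ := fun k => |(y k : ℝ) - y' k| with hD
  set B : ℕ → ℝ := fun k => ∑ i, ((a t : ℝ) ^ 2 + 2 * (x i (t - 1 - k) : ℝ) ^ 2) with hB
  have hnat : ∀ p z : ℕ, (1 + (p : ℝ)) * z ≤ (p : ℝ) ^ 2 + 2 * (z : ℝ) ^ 2 := by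
    intro p z
    have hz : (z : ℝ) ≤ (z : ℝ) ^ 2 := by exact_mod_cast Nat.le_self_pow two_ne_zero z
    nlinarith [sq_nonneg ((p : ℝ) - z), sq_nonneg (p : ℝ)]
  have hDB : ∀ k, (1 + (a t : ℝ)) * D k ≤ B k := by
    intro k
    have h1 : D k ≤ ∑ i, (x i (t - 1 - k) : ℝ) := by
      have e1 : (y k : ℝ) ≤ ∑ i, (x i (t - 1 - k) : ℝ) := by exact_mod_cast hy k
      have e2 : (y' k : ℝ) ≤ ∑ i, (x i (t - 1 - k) : ℝ) := by exact_mod_cast hy' k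
      have e3 : (0 : ℝ) ≤ y k := Nat.cast_nonneg _
      have e4 : (0 : ℝ) ≤ y' k := Nat.cast_nonneg _
      rw [hD, abs_le]
      constructor <;> linarith
    calc (1 + (a t : ℝ)) * D k ≤ (1 + (a t : ℝ)) * ∑ i, (x i (t - 1 - k) : ℝ) := by gcongr
      _ = ∑ i, (1 + (a t : ℝ)) * (x i (t - 1 - k) : ℝ) := Finset.mul_sum _ _ _
      _ ≤ B k := Finset.sum_le_sum fun i _ => hnat _ _
  have hpart : ∀ i, HasSum (fun k : ℕ => α (k + m) *
      ((a t : ℝ) ^ 2 + 2 * (x i (t - 1 - (k + m : ℕ)) : ℝ) ^ 2))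
      (tailCoef α m * (a t : ℝ) ^ 2 + 2 * tailSq α m (x i) t) := by
    intro i
    have s1 := (((summable_nat_add_iff m).2 hα).hasSum).mul_right ((a t : ℝ) ^ 2)
    have s2 := (((summable_nat_add_iff (f := fun k : ℕ => α k * (x i (t - 1 - k) : ℝ) ^ 2) m).2
      (hx i)).hasSum).mul_left 2
    refine (s1.add s2).congr_fun ?_
    intro k
    ring
  have hBsum : HasSum (fun k => α (k + m) * B (k + m)) (errBound α x a m t) := by
    refine (hasSum_sum fun i (_ : i ∈ Finset.univ) => hpart i).congr_fun ?_
    intro k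
    rw [hB, Finset.mul_sum]
  have hDle : ∀ k, α (k + m) * ((1 + (a t : ℝ)) * D (k + m)) ≤ α (k + m) * B (k + m) := fun k =>
    mul_le_mul_of_nonneg_left (hDB _) (h0 _)
  have hDs : Summable fun k => α (k + m) * ((1 + (a t : ℝ)) * D (k + m)) :=
    Summable.of_nonneg_of_le (fun k => mul_nonneg (h0 _)
      (mul_nonneg (by positivity) (abs_nonneg _))) hDle hBsum.summable
  have ha : (1 + (a t : ℝ)) ≠ 0 := by positivity
  have hfull : Summable fun k => α k * ((1 + (a t : ℝ)) * D k) :=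
    (summable_nat_add_iff (f := fun k => α k * ((1 + (a t : ℝ)) * D k)) m).1 hDs
  have hDsum : Summable fun k => α k * D k := by
    have := hfull.mul_left (1 + (a t : ℝ))⁻¹
    refine this.congr fun k => ?_
    field_simp
  refine ⟨hDsum, ?_⟩
  rw [← tsum_mul_left]
  have e1 : (fun k => (1 + (a t : ℝ)) * (α k * D k)) = fun k => α k * ((1 + (a t : ℝ)) * D k) := by
    funext k; ring
  change ∑' k, (1 + (a t : ℝ)) * (α k * D k) ≤ _
  rw [e1, ← hfull.sum_add_tsum_nat_add m, Finset.sum_eq_zero, zero_add, ← hBsum.tsum_eq]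
  · exact hDs.tsum_le_tsum hDle hBsum.summable
  · intro k hk
    simp [hD, hyy k (Finset.mem_range.1 hk)]

end Deterministic

/-- The contribution `a log b - b` of one observation to the Poisson log-likelihood is Lipschitz in
the mean `b` away from `0`. -/
lemma abs_poisson_sub_le {a b b' c : ℝ} (ha : 0 ≤ a) (hc : 0 < c) (hb : c ≤ b) (hb' : c ≤ b') :
    |(a * Real.log b - b) - (a * Real.log b' - b')| ≤ (1 + 1 / c) * ((1 + a) * |b - b'|) := by
  have hlog : ∀ u v : ℝ, c ≤ u → c ≤ v → Real.log u - Real.log v ≤ |u - v| / c := by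
    intro u v hu hv
    have hu0 : 0 < u := hc.trans_le hu
    have hv0 : 0 < v := hc.trans_le hv
    rw [← Real.log_div hu0.ne' hv0.ne']
    calc Real.log (u / v) ≤ u / v - 1 := Real.log_le_sub_one_of_pos (by positivity)
      _ = (u - v) / v := by field_simp
      _ ≤ |u - v| / v := by gcongr; exact le_abs_self _
      _ ≤ |u - v| / c := by gcongr
  have h1 : |Real.log b - Real.log b'| ≤ |b - b'| / c := by
    rw [abs_le]
    have := hlog b' b hb' hb
    rw [abs_sub_comm] at this
    exact ⟨by linarith, hlog b b' hb hb'⟩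
  have e : (a * Real.log b - b) - (a * Real.log b' - b')
      = a * (Real.log b - Real.log b') - (b - b') := by ring
  have hd : 0 ≤ |b - b'| := abs_nonneg _
  rw [e]
  calc |a * (Real.log b - Real.log b') - (b - b')|
      ≤ |a * (Real.log b - Real.log b')| + |b - b'| := abs_sub _ _
    _ = a * |Real.log b - Real.log b'| + |b - b'| := by rw [abs_mul, abs_of_nonneg ha]
    _ ≤ a * (|b - b'| / c) + |b - b'| := by gcongr
    _ ≤ (1 + 1 / c) * ((1 + a) * |b - b'|) := by
      have h2 : 0 ≤ |b - b'| / c := by positivity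
      have h3 : 0 ≤ a * |b - b'| := by positivity
      have : (1 + 1 / c) * ((1 + a) * |b - b'|)
        = a * (|b - b'| / c) + |b - b'| + |b - b'| / c + a * |b - b'| := by ring
      linarith

/-! ### Stationary ergodic laws on the path space -/

/-- The shift on the path space. -/
abbrev pathShift (x : ℤ → ℕ) (t : ℤ) : ℕ := x (t + 1)

lemma pathShift_iterate (n : ℕ) (x : ℤ → ℕ) : pathShift^[n] x = fun t => x (t + n) := by
  induction n generalizing x with
  | zero => simp
  | succ n ih =>
    rw [Function.iterate_succ_apply, ih]
    funext t
    simp only [pathShift]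
    congr 1
    push_cast
    ring

section PathLaw

variable {ν : Measure (ℤ → ℕ)} {α : ℕ → ℝ}

lemma lintegral_path_sq (hS : MeasurePreserving pathShift ν ν) (t : ℤ) :
    ∫⁻ x, (x t : ℝ≥0∞) ^ 2 ∂ν = ∫⁻ x, (x 0 : ℝ≥0∞) ^ 2 ∂ν := by
  have hmeas : ∀ s : ℤ, Measurable fun x : ℤ → ℕ => (x s : ℝ≥0∞) ^ 2 := fun s =>
    ((measurable_of_countable (fun k : ℕ => (k : ℝ≥0∞) ^ 2)).comp (measurable_pi_apply s))
  have hshift : ∀ (n : ℕ) (s : ℤ), ∫⁻ x, (x (s + n) : ℝ≥0∞) ^ 2 ∂ν = ∫⁻ x, (x s : ℝ≥0∞) ^ 2 ∂ν := by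
    intro n s
    rw [← (hS.iterate n).lintegral_comp (hmeas s)]
    simp only [pathShift_iterate]
  rcases le_total 0 t with h | h
  · have := hshift t.toNat 0
    rwa [zero_add, Int.toNat_of_nonneg h] at this
  · have := hshift (-t).toNat t
    rw [Int.toNat_of_nonneg (by omega), add_neg_cancel] at this
    exact this.symm

lemma measurable_path_sq (t : ℤ) : Measurable fun x : ℤ → ℕ => (x t : ℝ) ^ 2 :=
  (measurable_of_countable (fun k : ℕ => (k : ℝ) ^ 2)).comp (measurable_pi_apply t)

lemma integrable_path_sq (hQ : ∫⁻ x, (x 0 : ℝ≥0∞) ^ 2 ∂ν ≠ ∞) :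
    Integrable (fun x => (x 0 : ℝ) ^ 2) ν := by
  have h : (fun x : ℤ → ℕ => (x 0 : ℝ) ^ 2) = fun x => ((x 0 : ℝ≥0∞) ^ 2).toReal := by
    funext x; simp
  rw [h]
  refine integrable_toReal_of_lintegral_ne_top ?_ hQ
  exact ((measurable_of_countable (fun k : ℕ => (k : ℝ≥0∞) ^ 2)).comp
    (measurable_pi_apply 0)).aemeasurable

lemma tailSq_eq_toReal (h0 : ∀ k, 0 ≤ α k) (m : ℕ) (x : ℤ → ℕ) (t : ℤ) :
    tailSq α m x t =
      (∑' k : ℕ, ENNReal.ofReal (α (k + m)) * (x (t - 1 - (k + m : ℕ)) : ℝ≥0∞) ^ 2).toReal := by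
  rw [ENNReal.tsum_toReal_eq]
  · refine tsum_congr fun k => ?_
    rw [ENNReal.toReal_mul, ENNReal.toReal_ofReal (h0 _)]
    simp
  · intro k
    exact ENNReal.mul_ne_top ENNReal.ofReal_ne_top (ENNReal.pow_ne_top (ENNReal.natCast_ne_top _))

lemma measurable_tsum_sq (α : ℕ → ℝ) (m : ℕ) (t : ℤ) : Measurable fun x : ℤ → ℕ =>
    ∑' k : ℕ, ENNReal.ofReal (α (k + m)) * (x (t - 1 - (k + m : ℕ)) : ℝ≥0∞) ^ 2 :=
  Measurable.tsum fun k => (measurable_of_countable (fun p : ℕ =>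
    ENNReal.ofReal (α (k + m)) * (p : ℝ≥0∞) ^ 2)).comp (measurable_pi_apply _)

lemma measurable_tailSq (h0 : ∀ k, 0 ≤ α k) (m : ℕ) (t : ℤ) :
    Measurable fun x => tailSq α m x t := by
  simp only [tailSq_eq_toReal h0]
  exact (measurable_tsum_sq α m t).ennreal_toReal

lemma lintegral_tsum_sq (hS : MeasurePreserving pathShift ν ν) (h0 : ∀ k, 0 ≤ α k)
    (hα : Summable α) (m : ℕ) (t : ℤ) :
    ∫⁻ x, ∑' k : ℕ, ENNReal.ofReal (α (k + m)) * (x (t - 1 - (k + m : ℕ)) : ℝ≥0∞) ^ 2 ∂ν =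
      ENNReal.ofReal (tailCoef α m) * ∫⁻ x, (x 0 : ℝ≥0∞) ^ 2 ∂ν := by
  have hm : ∀ s : ℤ, Measurable fun x : ℤ → ℕ => (x s : ℝ≥0∞) ^ 2 := fun s =>
    ((measurable_of_countable (fun k : ℕ => (k : ℝ≥0∞) ^ 2)).comp (measurable_pi_apply s))
  rw [lintegral_tsum fun k => ((hm _).const_mul _).aemeasurable]
  simp_rw [lintegral_const_mul _ (hm _), lintegral_path_sq hS]
  rw [ENNReal.tsum_mul_right, tailCoef,
    ENNReal.ofReal_tsum_of_nonneg (fun k => h0 _) ((summable_nat_add_iff m).2 hα)]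

lemma lintegral_tsum_sq_ne_top (hS : MeasurePreserving pathShift ν ν) (h0 : ∀ k, 0 ≤ α k)
    (hα : Summable α) (hQ : ∫⁻ x, (x 0 : ℝ≥0∞) ^ 2 ∂ν ≠ ∞) (m : ℕ) (t : ℤ) :
    ∫⁻ x, ∑' k : ℕ, ENNReal.ofReal (α (k + m)) * (x (t - 1 - (k + m : ℕ)) : ℝ≥0∞) ^ 2 ∂ν ≠ ∞ := by
  rw [lintegral_tsum_sq hS h0 hα]
  exact ENNReal.mul_ne_top ENNReal.ofReal_ne_top hQ

lemma integrable_tailSq (hS : MeasurePreserving pathShift ν ν) (h0 : ∀ k, 0 ≤ α k)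
    (hα : Summable α) (hQ : ∫⁻ x, (x 0 : ℝ≥0∞) ^ 2 ∂ν ≠ ∞) (m : ℕ) :
    Integrable (fun x => tailSq α m x 0) ν := by
  simp only [tailSq_eq_toReal h0]
  exact integrable_toReal_of_lintegral_ne_top (measurable_tsum_sq α m 0).aemeasurable
    (lintegral_tsum_sq_ne_top hS h0 hα hQ m 0)

lemma integral_tailSq (hS : MeasurePreserving pathShift ν ν) (h0 : ∀ k, 0 ≤ α k)
    (hα : Summable α) (hQ : ∫⁻ x, (x 0 : ℝ≥0∞) ^ 2 ∂ν ≠ ∞) (m : ℕ) :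
    ∫ x, tailSq α m x 0 ∂ν = tailCoef α m * (∫⁻ x, (x 0 : ℝ≥0∞) ^ 2 ∂ν).toReal := by
  simp only [tailSq_eq_toReal h0]
  rw [integral_toReal (measurable_tsum_sq α m 0).aemeasurable
    (ae_lt_top (measurable_tsum_sq α m 0) (lintegral_tsum_sq_ne_top hS h0 hα hQ m 0)),
    lintegral_tsum_sq hS h0 hα, ENNReal.toReal_mul, ENNReal.toReal_ofReal (tailCoef_nonneg h0 m)]

/-- Almost surely, the weighted sums of squares of the past are finite at all times. -/
lemma ae_summable_sq (hS : MeasurePreserving pathShift ν ν) (h0 : ∀ k, 0 ≤ α k)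
    (hα : Summable α) (hQ : ∫⁻ x, (x 0 : ℝ≥0∞) ^ 2 ∂ν ≠ ∞) :
    ∀ᵐ x ∂ν, ∀ t : ℤ, Summable fun k : ℕ => α k * (x (t - 1 - k) : ℝ) ^ 2 := by
  rw [ae_all_iff]
  intro t
  filter_upwards [ae_lt_top (measurable_tsum_sq α 0 t) (lintegral_tsum_sq_ne_top hS h0 hα hQ 0 t)]
    with x hx
  refine (ENNReal.summable_toReal hx.ne).congr fun k => ?_
  rw [ENNReal.toReal_mul, ENNReal.toReal_ofReal (h0 _)]
  simp

lemma tailSq_shift (m : ℕ) (x : ℤ → ℕ) (t : ℤ) :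
    tailSq α m (fun s => x (s + t)) 0 = tailSq α m x t := by
  refine tsum_congr fun k => ?_
  have h : 0 - 1 - ((k + m : ℕ) : ℤ) + t = t - 1 - (k + m : ℕ) := by ring
  simp only [h]

/-- The ergodic theorem along a path, with the shifts written out. -/
lemma ae_tendsto_path [IsProbabilityMeasure ν] (hS : Ergodic pathShift ν) {h : (ℤ → ℕ) → ℝ}
    (hh : Measurable h) (hi : Integrable h ν) :
    ∀ᵐ x ∂ν, Tendsto (fun n : ℕ => (∑ t ∈ Finset.range n, h fun s => x (s + t)) / n) atTop
      (𝓝 (∫ x, h x ∂ν)) := by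
  filter_upwards [ae_tendsto_birkhoff hS hh hi] with x hx
  simpa only [pathShift_iterate] using hx

end PathLaw

/-! ### The envelope of the conditional mean and of the quasi-likelihood -/

section Envelope

variable {d : ℕ} {f : (ℕ → ℕ) → Param d → ℝ} {Θ : Set (Param d)} {α : ℕ → ℝ}

/-- The lags `x_{t-1}, x_{t-2}, …` of a path at time `t`. -/
abbrev lags (x : ℤ → ℕ) (t : ℤ) : ℕ → ℕ := fun k => x (t - 1 - k)

/-- The Poisson log-likelihood of the observation `x_t` given the whole past. -/
noncomputable def contrib (f : (ℕ → ℕ) → Param d → ℝ) (θ : Param d) (x : ℤ → ℕ) (t : ℤ) : ℝ :=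
  (x t : ℝ) * Real.log (f (lags x t) θ) - f (lags x t) θ

lemma contrib_shift (θ : Param d) (x : ℤ → ℕ) (t : ℤ) :
    contrib f θ (fun s => x (s + t)) 0 = contrib f θ x t := by
  have : lags (fun s => x (s + t)) 0 = lags x t := by
    funext k
    simp only [lags]
    congr 1
    omega
  simp only [contrib, this, zero_add]

/-- The Lipschitz condition in terms of real series, when the right-hand side is finite. -/
lemma abs_sub_le_of_lipschitz (h0 : ∀ k, 0 ≤ α k)
    (hL : ∀ y y' : ℕ → ℕ, ⨆ θ ∈ Θ, ENNReal.ofReal |f y θ - f y' θ| ≤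
      ∑' k, ENNReal.ofReal (α k * |(y k : ℝ) - (y' k : ℝ)|))
    {θ : Param d} (hθ : θ ∈ Θ) {y y' : ℕ → ℕ}
    (hs : Summable fun k => α k * |(y k : ℝ) - y' k|) :
    |f y θ - f y' θ| ≤ ∑' k, α k * |(y k : ℝ) - y' k| := by
  have hnn : ∀ k, 0 ≤ α k * |(y k : ℝ) - y' k| := fun k => mul_nonneg (h0 k) (abs_nonneg _)
  have h1 := (le_iSup₂ (f := fun θ (_ : θ ∈ Θ) => ENNReal.ofReal |f y θ - f y' θ|) θ hθ).trans
    (hL y y')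
  rw [← ENNReal.ofReal_tsum_of_nonneg hnn hs] at h1
  exact (ENNReal.ofReal_le_ofReal_iff (tsum_nonneg hnn)).1 h1

/-- Changing the past beyond lag `m`, below the sum of the paths `x i`, changes the contribution of
an observation to the quasi-likelihood by at most a multiple of `errBound`. -/
lemma abs_poisson_sub_le_errBound {ι : Type*} [Fintype ι] (h0 : ∀ k, 0 ≤ α k) (hα : Summable α)
    (hL : ∀ y y' : ℕ → ℕ, ⨆ θ ∈ Θ, ENNReal.ofReal |f y θ - f y' θ| ≤
      ∑' k, ENNReal.ofReal (α k * |(y k : ℝ) - (y' k : ℝ)|))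
    {c : ℝ} (hc : 0 < c) (hfc : ∀ y, ∀ θ ∈ Θ, c ≤ f y θ)
    {θ : Param d} (hθ : θ ∈ Θ) {x : ι → ℤ → ℕ} (a : ℤ → ℕ) {t : ℤ}
    (hx : ∀ i, Summable fun k : ℕ => α k * (x i (t - 1 - k) : ℝ) ^ 2)
    {y y' : ℕ → ℕ} {m : ℕ} (hy : ∀ k, y k ≤ ∑ i, x i (t - 1 - k))
    (hy' : ∀ k, y' k ≤ ∑ i, x i (t - 1 - k)) (hyy : ∀ k < m, y k = y' k) :
    |((a t : ℝ) * Real.log (f y θ) - f y θ) - ((a t : ℝ) * Real.log (f y' θ) - f y' θ)| ≤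
      (1 + 1 / c) * errBound α x a m t := by
  obtain ⟨hs, hle⟩ := tsum_dist_le_errBound h0 hα a hx hy hy' hyy
  refine (abs_poisson_sub_le (Nat.cast_nonneg _) hc (hfc y θ hθ) (hfc y' θ hθ)).trans ?_
  refine mul_le_mul_of_nonneg_left (le_trans ?_ hle) (by positivity)
  exact mul_le_mul_of_nonneg_left (abs_sub_le_of_lipschitz h0 hL hθ hs) (by positivity)

/-- An integrable envelope, uniform in the parameter. -/
lemma exists_envelope {ν : Measure (ℤ → ℕ)} [IsProbabilityMeasure ν]
    (hS : MeasurePreserving pathShift ν ν) (hQ : ∫⁻ x, (x 0 : ℝ≥0∞) ^ 2 ∂ν ≠ ∞)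
    (hΘ : IsCompact Θ) (hcont : ∀ y, ContinuousOn (f y) Θ) (h0 : ∀ k, 0 ≤ α k) (hα : Summable α)
    (hL : ∀ y y' : ℕ → ℕ, ⨆ θ ∈ Θ, ENNReal.ofReal |f y θ - f y' θ| ≤
      ∑' k, ENNReal.ofReal (α k * |(y k : ℝ) - (y' k : ℝ)|))
    {c : ℝ} (hc : 0 < c) (hfc : ∀ y, ∀ θ ∈ Θ, c ≤ f y θ) :
    ∃ G : (ℤ → ℕ) → ℝ, Integrable G ν ∧
      ∀ᵐ x ∂ν, ∀ θ ∈ Θ, |contrib f θ x 0| ≤ G x ∧ |f (lags x 0) θ| ≤ G x := by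
  obtain ⟨C1, hC1⟩ := hΘ.exists_bound_of_continuousOn (hcont 0)
  obtain ⟨C2, hC2⟩ := hΘ.exists_bound_of_continuousOn
    ((hcont 0).log fun θ hθ => (hc.trans_le (hfc 0 θ hθ)).ne')
  set E : (ℤ → ℕ) → ℝ := fun x =>
    errBound α (fun _ : Unit => x) x 0 0 with hE
  have hEi : Integrable E ν := by
    simp only [hE, errBound, Finset.univ_unique, Finset.sum_singleton]
    exact ((integrable_path_sq hQ).const_mul _).add
      ((integrable_tailSq hS h0 hα hQ 0).const_mul 2)
  refine ⟨fun x => (1 + 1 / c) * E x + (|C2| * (x 0 : ℝ) ^ 2 + |C1|),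
    (hEi.const_mul _).add (((integrable_path_sq hQ).const_mul _).add (integrable_const _)), ?_⟩
  filter_upwards [ae_summable_sq hS h0 hα hQ] with x hx θ hθ
  have hb1 := (hC1 θ hθ).trans (le_abs_self _)
  have hb2 := (hC2 θ hθ).trans (le_abs_self _)
  rw [Real.norm_eq_abs] at hb1 hb2
  have hsq : (x 0 : ℝ) ≤ (x 0 : ℝ) ^ 2 := by exact_mod_cast Nat.le_self_pow two_ne_zero (x 0)
  have hx0 : (0 : ℝ) ≤ x 0 := Nat.cast_nonneg _
  have hy : ∀ k : ℕ, lags x 0 k ≤ ∑ _i : Unit, x (0 - 1 - k) := fun k => by simp [lags]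
  have hy' : ∀ k : ℕ, (0 : ℕ → ℕ) k ≤ ∑ _i : Unit, x (0 - 1 - k) := fun k => by simp
  have hE0 : 0 ≤ E x := errBound_nonneg h0 _ _ _ _
  have hx2 : 0 ≤ |C2| * (x 0 : ℝ) ^ 2 := by positivity
  constructor
  · have h1 := abs_poisson_sub_le_errBound h0 hα hL hc hfc hθ (x := fun _ : Unit => x) x (t := 0)
      (fun _ => hx 0) (m := 0) hy hy' (fun k hk => absurd hk (Nat.not_lt_zero k))
    have h2 : |(x 0 : ℝ) * Real.log (f 0 θ) - f 0 θ| ≤ |C2| * (x 0 : ℝ) ^ 2 + |C1| := by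
      refine (abs_sub _ _).trans (add_le_add ?_ hb1)
      rw [abs_mul, abs_of_nonneg hx0, mul_comm]
      gcongr
    have h3 := abs_add_le (contrib f θ x 0 - ((x 0 : ℝ) * Real.log (f 0 θ) - f 0 θ))
      ((x 0 : ℝ) * Real.log (f 0 θ) - f 0 θ)
    rw [sub_add_cancel] at h3
    simp only [contrib] at h3 ⊢
    linarith
  · obtain ⟨hs, hle⟩ := tsum_dist_le_errBound h0 hα x (x := fun _ : Unit => x) (t := 0)
      (fun _ => hx 0) (m := 0) hy hy' (fun k hk => absurd hk (Nat.not_lt_zero k))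
    have h1 := abs_sub_le_of_lipschitz h0 hL hθ hs
    have hT : 0 ≤ ∑' k, α k * |(lags x 0 k : ℝ) - ((0 : ℕ → ℕ) k : ℝ)| :=
      tsum_nonneg fun k => mul_nonneg (h0 k) (abs_nonneg _)
    have h2 : ∑' k, α k * |(lags x 0 k : ℝ) - ((0 : ℕ → ℕ) k : ℝ)| ≤ E x := by
      refine le_trans ?_ hle
      exact le_mul_of_one_le_left hT (by linarith)
    have h3 := abs_add_le (f (lags x 0) θ - f 0 θ) (f 0 θ)
    rw [sub_add_cancel] at h3
    have h4 : E x ≤ (1 + 1 / c) * E x := le_mul_of_one_le_left hE0 (by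
      have : 0 < 1 / c := by positivity
      linarith)
    linarith

lemma measurable_lags (t : ℤ) : Measurable fun x : ℤ → ℕ => lags x t :=
  measurable_pi_lambda _ fun _ => measurable_pi_apply _

lemma measurable_contrib {θ : Param d} (hm : Measurable fun y => f y θ) :
    Measurable fun x => contrib f θ x 0 := by
  have h1 : Measurable fun x : ℤ → ℕ => f (lags x 0) θ := hm.comp (measurable_lags 0)
  have h2 : Measurable fun x : ℤ → ℕ => (x 0 : ℝ) :=
    (measurable_of_countable (fun k : ℕ => (k : ℝ))).comp (measurable_pi_apply 0)
  exact (h2.mul h1.log).sub h1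

end Envelope

/-! ### The limit criterion and its maximum -/

lemma poisson_gibbs {u v : ℝ} (hu : 0 < u) (hv : 0 < v) :
    u * Real.log v - v ≤ u * Real.log u - u := by
  have h := mul_le_mul_of_nonneg_left (Real.log_le_sub_one_of_pos (div_pos hv hu)) hu.le
  rw [Real.log_div hv.ne' hu.ne', mul_sub, mul_sub, mul_div_cancel₀ _ hu.ne'] at h
  linarith

lemma eq_of_poisson_gibbs_eq {u v : ℝ} (hu : 0 < u) (hv : 0 < v)
    (h : u * Real.log v - v = u * Real.log u - u) : v = u := by
  by_contra hne
  have hne' : v / u ≠ 1 := fun h1 => hne ((div_eq_one_iff_eq hu.ne').1 h1)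
  have h1 := mul_lt_mul_of_pos_left (Real.log_lt_sub_one_of_pos (div_pos hv hu) hne') hu
  rw [Real.log_div hv.ne' hu.ne', mul_sub, mul_sub, mul_div_cancel₀ _ hu.ne'] at h1
  linarith

section Limit

variable {Ω : Type*}

lemma measurable_past_pastField (Y : ℤ → Ω → ℕ) (t : ℤ) :
    Measurable[pastField Y (t - 1)] (past Y t) := by
  refine @measurable_pi_lambda _ _ _ (pastField Y (t - 1)) _ _ fun k => ?_
  have h1 : MeasurableSpace.comap (Y (t - 1 - k)) inferInstance ≤ pastField Y (t - 1) :=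
    le_iSup (fun s : {s : ℤ // s ≤ t - 1} => MeasurableSpace.comap (Y s) inferInstance)
      ⟨t - 1 - k, by omega⟩
  exact (comap_measurable (Y (t - 1 - k))).mono h1 le_rfl

variable [MeasurableSpace Ω] {μ : Measure Ω} [IsProbabilityMeasure μ]
  {d : ℕ} {f : (ℕ → ℕ) → Param d → ℝ}

lemma pastField_le {Y : ℤ → Ω → ℕ} (hY : ∀ t, Measurable (Y t)) (t : ℤ) :
    pastField Y t ≤ (inferInstance : MeasurableSpace Ω) :=
  iSup_le fun s => (hY s).comap_le

/-- Conditioning on the past replaces the observation by its conditional mean. -/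
lemma integral_mul_log_condMean {θs θ : Param d} {Y : ℤ → Ω → ℕ} (hY : IsRegime μ f θs Y)
    (hm : Measurable fun y => f y θ) (hYi : Integrable (fun ω => (Y 0 ω : ℝ)) μ)
    (hi : Integrable (fun ω => (Y 0 ω : ℝ) * Real.log (f (past Y 0 ω) θ)) μ) :
    Integrable (fun ω => f (past Y 0 ω) θs * Real.log (f (past Y 0 ω) θ)) μ ∧
    ∫ ω, (Y 0 ω : ℝ) * Real.log (f (past Y 0 ω) θ) ∂μ =
      ∫ ω, f (past Y 0 ω) θs * Real.log (f (past Y 0 ω) θ) ∂μ := by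
  have hle := pastField_le hY.measurable (0 - 1)
  have hmeas : Measurable[pastField Y (0 - 1)] fun ω => Real.log (f (past Y 0 ω) θ) :=
    Real.measurable_log.comp (hm.comp (measurable_past_pastField Y 0))
  have hpull := condExp_mul_of_stronglyMeasurable_right (μ := μ) (m := pastField Y (0 - 1))
    (f := fun ω => (Y 0 ω : ℝ)) (g := fun ω => Real.log (f (past Y 0 ω) θ))
    hmeas.stronglyMeasurable hi hYi
  have hae : μ[(fun ω => (Y 0 ω : ℝ)) * (fun ω => Real.log (f (past Y 0 ω) θ)) |
      pastField Y (0 - 1)] =ᵐ[μ] fun ω => f (past Y 0 ω) θs * Real.log (f (past Y 0 ω) θ) := by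
    filter_upwards [hpull, hY.condMean 0] with ω h1 h2
    rw [h1, Pi.mul_apply, h2]
  refine ⟨integrable_condExp.congr hae, ?_⟩
  rw [← integral_congr_ae hae, integral_condExp hle]
  rfl

/-- The limit criterion is strictly larger at the true parameter than at any parameter that gives
another conditional mean. -/
lemma integral_contrib_lt {θs θ : Param d} {Y : ℤ → Ω → ℕ} (hY : IsRegime μ f θs Y)
    (hm : Measurable fun y => f y θ) (hms : Measurable fun y => f y θs)
    (hpos : ∀ y, 0 < f y θ) (hposs : ∀ y, 0 < f y θs)
    (hYi : Integrable (fun ω => (Y 0 ω : ℝ)) μ)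
    (hc : Integrable (fun ω => contrib f θ (fun t => Y t ω) 0) μ)
    (hcs : Integrable (fun ω => contrib f θs (fun t => Y t ω) 0) μ)
    (hf : Integrable (fun ω => f (past Y 0 ω) θ) μ)
    (hfs : Integrable (fun ω => f (past Y 0 ω) θs) μ)
    (hne : ¬ ∀ᵐ ω ∂μ, f (past Y 0 ω) θ = f (past Y 0 ω) θs) :
    ∫ ω, contrib f θ (fun t => Y t ω) 0 ∂μ < ∫ ω, contrib f θs (fun t => Y t ω) 0 ∂μ := by
  have key : ∀ θ' : Param d, Measurable (fun y => f y θ') →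
      Integrable (fun ω => contrib f θ' (fun t => Y t ω) 0) μ →
      Integrable (fun ω => f (past Y 0 ω) θ') μ →
      Integrable (fun ω => f (past Y 0 ω) θs * Real.log (f (past Y 0 ω) θ')
        - f (past Y 0 ω) θ') μ ∧
      ∫ ω, contrib f θ' (fun t => Y t ω) 0 ∂μ =
        ∫ ω, (f (past Y 0 ω) θs * Real.log (f (past Y 0 ω) θ') - f (past Y 0 ω) θ') ∂μ := by
    intro θ' hm' hc' hf'
    have hi : Integrable (fun ω => (Y 0 ω : ℝ) * Real.log (f (past Y 0 ω) θ')) μ := by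
      refine (hc'.add hf').congr (Eventually.of_forall fun ω => ?_)
      exact sub_add_cancel _ _
    obtain ⟨h1, h2⟩ := integral_mul_log_condMean hY hm' hYi hi
    refine ⟨h1.sub hf', ?_⟩
    rw [integral_sub h1 hf', ← h2, ← integral_sub hi hf']
    rfl
  obtain ⟨i1, e1⟩ := key θ hm hc hf
  obtain ⟨i2, e2⟩ := key θs hms hcs hfs
  rw [e1, e2]
  have hle : ∀ ω, f (past Y 0 ω) θs * Real.log (f (past Y 0 ω) θ) - f (past Y 0 ω) θ ≤
      f (past Y 0 ω) θs * Real.log (f (past Y 0 ω) θs) - f (past Y 0 ω) θs := fun ω =>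
    poisson_gibbs (hposs _) (hpos _)
  refine lt_of_le_of_ne (integral_mono i1 i2 hle) fun heq => hne ?_
  have hae := (integral_eq_iff_of_ae_le i1 i2 (Eventually.of_forall hle)).1 heq
  filter_upwards [hae] with ω hω
  exact eq_of_poisson_gibbs_eq (hposs _) (hpos _) hω

end Limit

/-! ### Local suprema of the quasi-likelihood -/

section Wald

variable {d : ℕ} {f : (ℕ → ℕ) → Param d → ℝ} {Θ : Set (Param d)}

/-- Wald's device: near `θ₀`, the contributions are dominated by a function whose mean is as close
as desired to the limit criterion at `θ₀`. Suprema are taken over a dense sequence of parameters, for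
the sake of measurability. -/
lemma exists_local_majorant {ν : Measure (ℤ → ℕ)} (hΘ : IsCompact Θ)
    (hcont : ∀ x, ContinuousOn (fun θ => contrib f θ x 0) Θ)
    (hmeas : ∀ θ ∈ Θ, Measurable fun x => contrib f θ x 0)
    {G : (ℤ → ℕ) → ℝ} (hG : Integrable G ν) (hfG : ∀ᵐ x ∂ν, ∀ θ ∈ Θ, |contrib f θ x 0| ≤ G x)
    {θ₀ : Param d} (hθ₀ : θ₀ ∈ Θ) {l : ℝ} (hl : ∫ x, contrib f θ₀ x 0 ∂ν < l) :
    ∃ r > 0, ∃ ψ : (ℤ → ℕ) → ℝ, Measurable ψ ∧ Integrable ψ ν ∧ ∫ x, ψ x ∂ν < l ∧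
      ∀ x, ∀ θ ∈ Θ, dist θ θ₀ < r → contrib f θ x 0 ≤ ψ x := by
  have : Nonempty Θ := ⟨⟨θ₀, hθ₀⟩⟩
  set D : ℕ → Θ := TopologicalSpace.denseSeq Θ with hD
  have hdense : DenseRange D := TopologicalSpace.denseRange_denseSeq Θ
  set I : ℕ → Type := fun m => {i : ℕ // dist (D i : Param d) θ₀ < 1 / ((m : ℝ) + 1)} with hI
  set ψ : ℕ → (ℤ → ℕ) → ℝ := fun m x => ⨆ i : I m, contrib f (D i.1) x 0 with hψ
  have hr : ∀ m : ℕ, (0 : ℝ) < 1 / ((m : ℝ) + 1) := fun m => by positivity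
  have hne : ∀ m, Nonempty (I m) := by
    intro m
    obtain ⟨i, hi⟩ := hdense.exists_dist_lt ⟨θ₀, hθ₀⟩ (hr m)
    rw [dist_comm] at hi
    exact ⟨⟨i, hi⟩⟩
  have hbdd : ∀ m x, BddAbove (Set.range fun i : I m => contrib f (D i.1) x 0) := by
    intro m x
    refine (hΘ.bddAbove_image (hcont x)).mono ?_
    rintro _ ⟨i, rfl⟩
    exact ⟨D i.1, (D i.1).2, rfl⟩
  have hcontΘ : ∀ x, Continuous fun θ : Θ => contrib f (θ : Param d) x 0 := fun x =>
    continuousOn_iff_continuous_domRestrict.1 (hcont x)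
  have hub : ∀ (m : ℕ) x, ∀ θ ∈ Θ, dist θ θ₀ < 1 / ((m : ℝ) + 1) → contrib f θ x 0 ≤ ψ m x := by
    intro m x θ hθ hd
    have hclosed : IsClosed {θ : Θ | contrib f (θ : Param d) x 0 ≤ ψ m x} :=
      isClosed_le (hcontΘ x) continuous_const
    have hopen : IsOpen {θ : Θ | dist (θ : Param d) θ₀ < 1 / ((m : ℝ) + 1)} :=
      isOpen_lt (by fun_prop) continuous_const
    have hsub : {θ : Θ | dist (θ : Param d) θ₀ < 1 / ((m : ℝ) + 1)} ∩ Set.range D ⊆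
        {θ : Θ | contrib f (θ : Param d) x 0 ≤ ψ m x} := by
      rintro _ ⟨h1, i, rfl⟩
      exact le_ciSup (hbdd m x) (⟨i, h1⟩ : I m)
    exact closure_minimal hsub hclosed (hdense.open_subset_closure_inter hopen
      (show (⟨θ, hθ⟩ : Θ) ∈ _ from hd))
  have hψm : ∀ m, Measurable (ψ m) := fun m =>
    Measurable.iSup fun i => hmeas _ (D i.1).2
  have hψG : ∀ m, ∀ᵐ x ∂ν, ‖ψ m x‖ ≤ G x := by
    intro m
    filter_upwards [hfG] with x hx
    have := hne m
    rw [Real.norm_eq_abs, abs_le]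
    exact ⟨(abs_le.1 (hx θ₀ hθ₀)).1.trans (hub m x θ₀ hθ₀ (by rw [dist_self]; exact hr m)),
      ciSup_le fun i => (abs_le.1 (hx _ (D i.1).2)).2⟩
  have hlim : ∀ x, Tendsto (fun m => ψ m x) atTop (𝓝 (contrib f θ₀ x 0)) := by
    intro x
    rw [Metric.tendsto_nhds]
    intro ε hε
    obtain ⟨δ, hδ, hδε⟩ := Metric.continuousOn_iff.1 (hcont x) θ₀ hθ₀ (ε / 2) (half_pos hε)
    obtain ⟨N, hN⟩ := exists_nat_one_div_lt hδ
    filter_upwards [eventually_ge_atTop N] with m hm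
    have := hne m
    have h1 : contrib f θ₀ x 0 ≤ ψ m x := hub m x θ₀ hθ₀ (by rw [dist_self]; exact hr m)
    have h2 : ψ m x ≤ contrib f θ₀ x 0 + ε / 2 := by
      refine ciSup_le fun i => ?_
      have h3 : 1 / ((m : ℝ) + 1) ≤ 1 / ((N : ℝ) + 1) :=
        one_div_le_one_div_of_le (by positivity) (by gcongr)
      have h4 := hδε _ (D i.1).2 (i.2.trans_le (h3.trans hN.le))
      rw [Real.dist_eq] at h4
      linarith [(abs_lt.1 h4).2]
    rw [Real.dist_eq, abs_lt]
    constructor <;> linarith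
  have hint := tendsto_integral_of_dominated_convergence G
    (fun m => (hψm m).aestronglyMeasurable) hG hψG (Eventually.of_forall hlim)
  obtain ⟨m, hm⟩ := (hint.eventually_lt_const hl).exists
  exact ⟨1 / ((m : ℝ) + 1), hr m, ψ m, hψm m,
    hG.mono' (hψm m).aestronglyMeasurable (hψG m), hm, hub m⟩

end Wald

/-! ### The segments -/

section Segments

variable {K : ℕ} {τ : Fin (K + 1) → ℝ}

lemma breakDate_mono (hτ : StrictMono τ) (n : ℕ) : Monotone (breakDate τ n) := fun _ _ h =>
  Int.floor_le_floor (mul_le_mul_of_nonneg_left (hτ.monotone h) n.cast_nonneg)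

lemma tau_nonneg (hτ : StrictMono τ) (hτ0 : τ 0 = 0) (i : Fin (K + 1)) : 0 ≤ τ i := by
  rw [← hτ0]
  exact hτ.monotone (Fin.zero_le i)

lemma breakDate_nonneg (hτ : StrictMono τ) (hτ0 : τ 0 = 0) (n : ℕ) (i : Fin (K + 1)) :
    0 ≤ breakDate τ n i :=
  Int.floor_nonneg.2 (mul_nonneg n.cast_nonneg (tau_nonneg hτ hτ0 i))

lemma tendsto_breakDate_div (hτ : StrictMono τ) (hτ0 : τ 0 = 0) (i : Fin (K + 1)) :
    Tendsto (fun n : ℕ => (breakDate τ n i : ℝ) / n) atTop (𝓝 (τ i)) := by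
  have h := (tendsto_nat_floor_mul_div_atTop (tau_nonneg hτ hτ0 i)).comp
    (tendsto_natCast_atTop_atTop (R := ℝ))
  refine h.congr fun n => ?_
  have h0 : 0 ≤ τ i * (n : ℝ) := mul_nonneg (tau_nonneg hτ hτ0 i) n.cast_nonneg
  simp only [Function.comp_apply, breakDate]
  rw [natCast_floor_eq_intCast_floor h0, mul_comm]

lemma observed_eq {Ω : Type*} (hτ : StrictMono τ) (Y : Fin K → ℤ → Ω → ℕ) {n : ℕ} {j : Fin K}
    {t : ℤ} (ht : t ∈ trueSegment τ n j) (ω : Ω) : observed τ Y n t ω = Y j t ω := by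
  unfold observed
  rw [Finset.sum_eq_single j, if_pos ht]
  · intro i _ hij
    rw [if_neg]
    intro hi
    simp only [trueSegment, Finset.mem_Ioc] at ht hi
    rcases lt_or_gt_of_ne hij with h | h
    · have := breakDate_mono hτ n (show i.succ ≤ j.castSucc by
        rw [Fin.le_def]; simpa using h)
      omega
    · have := breakDate_mono hτ n (show j.succ ≤ i.castSucc by
        rw [Fin.le_def]; simpa using h)
      omega
  · simp

lemma observed_le {Ω : Type*} (Y : Fin K → ℤ → Ω → ℕ) (n : ℕ) (t : ℤ) (ω : Ω) :
    observed τ Y n t ω ≤ ∑ j, Y j t ω :=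
  Finset.sum_le_sum fun j _ => by split_ifs <;> simp

end Segments

/-! ### Transfer to the observations -/

section Regime

variable {Ω : Type*} [MeasurableSpace Ω] {μ : Measure Ω} {d : ℕ} {f : (ℕ → ℕ) → Param d → ℝ}
  {θs : Param d} {Y : ℤ → Ω → ℕ}

/-- The law of a process on the path space. -/
noncomputable abbrev pathLaw (μ : Measure Ω) (Y : ℤ → Ω → ℕ) : Measure (ℤ → ℕ) :=
  μ.map fun ω t => Y t ω

lemma IsRegime.measurable_path (hY : IsRegime μ f θs Y) : Measurable fun ω t => Y t ω :=
  measurable_pi_lambda _ hY.measurable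

lemma IsRegime.ergodic (hY : IsRegime μ f θs Y) : Ergodic pathShift (pathLaw μ Y) :=
  hY.stationary_ergodic

lemma IsRegime.lintegral_sq_ne_top (hY : IsRegime μ f θs Y) :
    ∫⁻ x, (x 0 : ℝ≥0∞) ^ 2 ∂(pathLaw μ Y) ≠ ∞ := by
  obtain ⟨C, -, ε, hε, hC⟩ := hY.moment
  have hm : Measurable fun x : ℤ → ℕ => (x 0 : ℝ≥0∞) ^ 2 :=
    (measurable_of_countable (fun k : ℕ => (k : ℝ≥0∞) ^ 2)).comp (measurable_pi_apply 0)
  rw [lintegral_map hm hY.measurable_path]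
  refine ((lintegral_mono fun ω => ?_).trans_lt ((hC 0).trans ENNReal.ofReal_lt_top)).ne
  rcases Nat.eq_zero_or_pos (Y 0 ω) with h | h
  · simp [h]
  · have h1 : (1 : ℝ≥0∞) ≤ (Y 0 ω : ℝ≥0∞) := by exact_mod_cast h
    calc (Y 0 ω : ℝ≥0∞) ^ 2 = (Y 0 ω : ℝ≥0∞) ^ (2 : ℝ) := by
          rw [← ENNReal.rpow_natCast]; norm_num
      _ ≤ (Y 0 ω : ℝ≥0∞) ^ (1 + ε) := ENNReal.rpow_le_rpow_of_exponent_le h1 (by linarith)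

lemma IsRegime.integrable_path_comp (hY : IsRegime μ f θs Y) {h : (ℤ → ℕ) → ℝ}
    (hi : Integrable h (pathLaw μ Y)) : Integrable (fun ω => h fun t => Y t ω) μ :=
  hi.comp_measurable hY.measurable_path

lemma IsRegime.ae_path (hY : IsRegime μ f θs Y) {p : (ℤ → ℕ) → Prop}
    (hp : ∀ᵐ x ∂(pathLaw μ Y), p x) : ∀ᵐ ω ∂μ, p fun t => Y t ω :=
  ae_of_ae_map hY.measurable_path.aemeasurable hp

lemma IsRegime.ae_tendsto_average [IsProbabilityMeasure μ] (hY : IsRegime μ f θs Y)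
    {h : (ℤ → ℕ) → ℝ} (hh : Measurable h) (hi : Integrable h (pathLaw μ Y)) :
    ∀ᵐ ω ∂μ, Tendsto (fun n : ℕ => (∑ t ∈ Finset.range n, h fun s => Y (s + t) ω) / n) atTop
      (𝓝 (∫ x, h x ∂(pathLaw μ Y))) := by
  have : IsProbabilityMeasure (pathLaw μ Y) :=
    Measure.isProbabilityMeasure_map hY.measurable_path.aemeasurable
  exact hY.ae_path (ae_tendsto_path hY.ergodic hh hi)

end Regime

section Observations

variable {Ω : Type*} {d K : ℕ} {f : (ℕ → ℕ) → Param d → ℝ} {Θ : Set (Param d)} {α : ℕ → ℝ}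
  {τ : Fin (K + 1) → ℝ} {Y : Fin K → ℤ → Ω → ℕ}

/-- On its own segment, the quasi-likelihood of the observations is close to that of the regime with
its whole past, uniformly in the parameter: the lags up to the start of the segment agree. -/
lemma abs_quasiLogLik_sub_le (h0 : ∀ k, 0 ≤ α k) (hα : Summable α)
    (hL : ∀ y y' : ℕ → ℕ, ⨆ θ ∈ Θ, ENNReal.ofReal |f y θ - f y' θ| ≤
      ∑' k, ENNReal.ofReal (α k * |(y k : ℝ) - (y' k : ℝ)|))
    {c : ℝ} (hc : 0 < c) (hfc : ∀ y, ∀ θ ∈ Θ, c ≤ f y θ)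
    (hτ : StrictMono τ) (hτ0 : τ 0 = 0) (n : ℕ) (j : Fin K) {ω : Ω}
    (hx : ∀ i (t : ℤ), Summable fun k : ℕ => α k * (Y i (t - 1 - k) ω : ℝ) ^ 2)
    {θ : Param d} (hθ : θ ∈ Θ) :
    |quasiLogLik f (observed τ Y n) (trueSegment τ n j) θ ω -
        ∑ t ∈ trueSegment τ n j, contrib f θ (fun s => Y j s ω) t| ≤
      (1 + 1 / c) * ∑ t ∈ trueSegment τ n j,
        errBound α (fun i s => Y i s ω) (fun s => Y j s ω)
          (t - 1 - breakDate τ n j.castSucc).toNat t := by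
  rw [quasiLogLik, ← Finset.sum_sub_distrib, Finset.mul_sum]
  refine (Finset.abs_sum_le_sum_abs _ _).trans (Finset.sum_le_sum fun t ht => ?_)
  rw [observed_eq hτ Y ht ω]
  refine abs_poisson_sub_le_errBound h0 hα hL hc hfc hθ (x := fun i s => Y i s ω)
    (fun s => Y j s ω) (fun i => hx i t) ?_ ?_ ?_
  · intro k
    unfold truncPast
    split_ifs
    · exact observed_le Y n _ ω
    · exact Nat.zero_le _
  · intro k
    exact Finset.single_le_sum (f := fun i => Y i (t - 1 - k) ω) (fun i _ => Nat.zero_le _)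
      (Finset.mem_univ j)
  · intro k hk
    have hs := breakDate_nonneg hτ hτ0 n j.castSucc
    have ht' := Finset.mem_Ioc.1 ht
    have hmem : t - 1 - k ∈ trueSegment τ n j := Finset.mem_Ioc.2 (by omega)
    unfold truncPast
    rw [if_pos (WithBot.coe_lt_coe.2 (by omega)), observed_eq hτ Y hmem ω]

lemma argmaxQL_nonempty (hΘ : IsCompact Θ) (hne : Θ.Nonempty) (hcont : ∀ y, ContinuousOn (f y) Θ)
    (hpos : ∀ y, ∀ θ ∈ Θ, 0 < f y θ) (X : ℤ → Ω → ℕ) (T : Finset ℤ) (ω : Ω) :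
    (argmaxQL f Θ X T ω).Nonempty := by
  obtain ⟨θ, hθ, hmax⟩ := hΘ.exists_isMaxOn hne
    (f := fun θ => quasiLogLik f X T θ ω) (by
      refine continuousOn_finsetSum _ fun t _ => ?_
      exact (continuousOn_const.mul ((hcont _).log fun θ hθ => (hpos _ θ hθ).ne')).sub (hcont _))
  exact ⟨θ, hθ, hmax⟩

variable [MeasurableSpace Ω] {μ : Measure Ω} [IsProbabilityMeasure μ] {θs : Fin K → Param d}

/-- The errors due to the unobserved or foreign past are negligible on average. -/
lemma ae_tendsto_errBound (hY : ∀ j, IsRegime μ f (θs j) (Y j)) (h0 : ∀ k, 0 ≤ α k)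
    (hα : Summable α) (hτ : StrictMono τ) (hτ0 : τ 0 = 0) (j : Fin K) :
    ∀ᵐ ω ∂μ, (∀ i (t : ℤ), Summable fun k : ℕ => α k * (Y i (t - 1 - k) ω : ℝ) ^ 2) ∧
      Tendsto (fun n : ℕ => (∑ t ∈ trueSegment τ n j,
        errBound α (fun i s => Y i s ω) (fun s => Y j s ω)
          (t - 1 - breakDate τ n j.castSucc).toNat t) / n) atTop (𝓝 0) := by
  have hsum : ∀ i, ∀ᵐ ω ∂μ, ∀ t : ℤ, Summable fun k : ℕ => α k * (Y i (t - 1 - k) ω : ℝ) ^ 2 :=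
    fun i => (hY i).ae_path (ae_summable_sq (hY i).ergodic.toMeasurePreserving h0 hα
      (hY i).lintegral_sq_ne_top)
  have hsq := (hY j).ae_tendsto_average (measurable_path_sq 0)
    (integrable_path_sq (hY j).lintegral_sq_ne_top)
  have htail : ∀ (i : Fin K) (m : ℕ), ∀ᵐ ω ∂μ,
      Tendsto (fun n : ℕ => (∑ t ∈ Finset.range n, tailSq α m (fun s => Y i s ω) t) / n) atTop
        (𝓝 (tailCoef α m * (∫⁻ x, (x 0 : ℝ≥0∞) ^ 2 ∂(pathLaw μ (Y i))).toReal)) := by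
    intro i m
    have hS := (hY i).ergodic.toMeasurePreserving
    have hQ := (hY i).lintegral_sq_ne_top
    filter_upwards [(hY i).ae_tendsto_average (measurable_tailSq h0 m 0)
      (integrable_tailSq hS h0 hα hQ m)] with ω hω
    rw [integral_tailSq hS h0 hα hQ m] at hω
    refine hω.congr fun n => ?_
    congr 1
    exact Finset.sum_congr rfl fun t _ => tailSq_shift m (fun s => Y i s ω) t
  filter_upwards [ae_all_iff.2 hsum, hsq, ae_all_iff.2 fun i => ae_all_iff.2 (htail i)]
    with ω h1 h2 h3
  refine ⟨h1, ?_⟩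
  simp only [zero_add] at h2
  refine tendsto_sum_Ioc_diag
    (u := errBound α (fun i s => Y i s ω) (fun s => Y j s ω))
    (c := fun m => ∑ i, (tailCoef α m * (∫ x, (x 0 : ℝ) ^ 2 ∂(pathLaw μ (Y j))) +
      2 * (tailCoef α m * (∫⁻ x, (x 0 : ℝ≥0∞) ^ 2 ∂(pathLaw μ (Y i))).toReal)))
    (errBound_nonneg h0 _ _) (fun t => antitone_errBound h0 hα _ fun i => h1 i t) ?_ ?_
    (fun n => breakDate_nonneg hτ hτ0 n _)
    (fun n => breakDate_mono hτ n (Fin.castSucc_lt_succ).le)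
    (tendsto_breakDate_div hτ hτ0 _) (tendsto_breakDate_div hτ hτ0 _)
  · intro m
    have := tendsto_finsetSum (Finset.univ : Finset (Fin K)) fun i _ =>
      (h2.const_mul (tailCoef α m)).add ((h3 i m).const_mul 2)
    refine this.congr fun n => ?_
    simp only [errBound]
    rw [Finset.sum_comm (s := Finset.range n)]
    conv_rhs => rw [Finset.sum_div]
    refine Finset.sum_congr rfl fun i _ => ?_
    rw [Finset.sum_add_distrib, ← Finset.mul_sum, ← Finset.mul_sum, add_div, mul_div_assoc,
      mul_div_assoc]
  · have := tendsto_finsetSum (Finset.univ : Finset (Fin K)) fun i _ =>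
      ((tendsto_tailCoef α).mul_const (∫ x, (x 0 : ℝ) ^ 2 ∂(pathLaw μ (Y j)))).add
        (((tendsto_tailCoef α).mul_const
          (∫⁻ x, (x 0 : ℝ≥0∞) ^ 2 ∂(pathLaw μ (Y i))).toReal).const_mul 2)
    simpa using this

/-- Near a parameter with a smaller limit criterion than the true one there is eventually no
maximizer. -/
lemma ae_eventually_not_mem_argmaxQL (hY : ∀ j, IsRegime μ f (θs j) (Y j)) (hΘ : IsCompact Θ)
    (hcont : ∀ y, ContinuousOn (f y) Θ) (hmeas : ∀ θ ∈ Θ, Measurable fun y => f y θ)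
    (h0 : ∀ k, 0 ≤ α k) (hα : Summable α)
    (hL : ∀ y y' : ℕ → ℕ, ⨆ θ ∈ Θ, ENNReal.ofReal |f y θ - f y' θ| ≤
      ∑' k, ENNReal.ofReal (α k * |(y k : ℝ) - (y' k : ℝ)|))
    {c : ℝ} (hc : 0 < c) (hfc : ∀ y, ∀ θ ∈ Θ, c ≤ f y θ)
    (hτ : StrictMono τ) (hτ0 : τ 0 = 0) (j : Fin K) (hθs : θs j ∈ Θ)
    {θ₀ : Param d} (hθ₀ : θ₀ ∈ Θ)
    (hlt : ∫ x, contrib f θ₀ x 0 ∂(pathLaw μ (Y j)) < ∫ x, contrib f (θs j) x 0 ∂(pathLaw μ (Y j)))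
    {G : (ℤ → ℕ) → ℝ} (hG : Integrable G (pathLaw μ (Y j)))
    (hfG : ∀ᵐ x ∂(pathLaw μ (Y j)), ∀ θ ∈ Θ, |contrib f θ x 0| ≤ G x) :
    ∃ r > 0, ∀ᵐ ω ∂μ, ∀ᶠ n : ℕ in atTop, ∀ θ, dist θ θ₀ < r →
      θ ∉ argmaxQL f Θ (observed τ Y n) (trueSegment τ n j) ω := by
  have hcm : ∀ θ ∈ Θ, Measurable fun x => contrib f θ x 0 := fun θ hθ =>
    measurable_contrib (hmeas θ hθ)
  obtain ⟨r, hr, ψ, hψm, hψi, hψl, hψ⟩ := exists_local_majorant hΘ (fun x =>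
    (continuousOn_const.mul ((hcont _).log fun θ hθ => (hc.trans_le (hfc _ θ hθ)).ne')).sub
      (hcont _)) hcm hG hfG hθ₀ hlt
  have hsi : Integrable (fun x => contrib f (θs j) x 0) (pathLaw μ (Y j)) :=
    hG.mono' (hcm _ hθs).aestronglyMeasurable (hfG.mono fun x hx => hx _ hθs)
  refine ⟨r, hr, ?_⟩
  filter_upwards [ae_tendsto_errBound hY h0 hα hτ hτ0 j, (hY j).ae_tendsto_average hψm hψi,
    (hY j).ae_tendsto_average (hcm _ hθs) hsi] with ω hE h1 h2
  obtain ⟨hx, hE⟩ := hE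
  have hs0 := fun n => breakDate_nonneg hτ hτ0 n j.castSucc
  have hse := fun n => breakDate_mono hτ n (Fin.castSucc_lt_succ (i := j)).le
  have ls := tendsto_breakDate_div hτ hτ0 j.castSucc
  have le := tendsto_breakDate_div hτ hτ0 j.succ
  have w1 := tendsto_sum_Ioc_div (a := fun t => ψ fun s => Y j (s + t) ω) h1 hs0 hse ls le
  have w2 := tendsto_sum_Ioc_div (a := fun t => contrib f (θs j) (fun s => Y j (s + t) ω) 0)
    h2 hs0 hse ls le
  have hΔ : 0 < τ j.succ - τ j.castSucc := sub_pos.2 (hτ Fin.castSucc_lt_succ)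
  have hgap := (w2.sub w1).sub ((hE.const_mul (1 + 1 / c)).const_mul 2)
  have hgap0 : 0 < (τ j.succ - τ j.castSucc) * (∫ x, contrib f (θs j) x 0 ∂(pathLaw μ (Y j)))
      - (τ j.succ - τ j.castSucc) * (∫ x, ψ x ∂(pathLaw μ (Y j)))
      - 2 * ((1 + 1 / c) * 0) := by
    have := mul_lt_mul_of_pos_left hψl hΔ
    linarith
  filter_upwards [hgap.eventually_const_lt hgap0, eventually_gt_atTop 0] with n hn hn0 θ hd hmax
  have hn0' : (0 : ℝ) < n := by exact_mod_cast hn0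
  have b1 := (abs_le.1 (abs_quasiLogLik_sub_le h0 hα hL hc hfc hτ hτ0 n j hx hmax.1)).2
  have b2 := (abs_le.1 (abs_quasiLogLik_sub_le h0 hα hL hc hfc hτ hτ0 n j hx hθs)).1
  have b3 : quasiLogLik f (observed τ Y n) (trueSegment τ n j) (θs j) ω ≤
      quasiLogLik f (observed τ Y n) (trueSegment τ n j) θ ω := hmax.2 hθs
  have b4 : ∑ t ∈ trueSegment τ n j, contrib f θ (fun s => Y j s ω) t ≤
      ∑ t ∈ trueSegment τ n j, ψ fun s => Y j (s + t) ω := by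
    refine Finset.sum_le_sum fun t _ => ?_
    rw [← contrib_shift]
    exact hψ _ θ hmax.1 hd
  have hshift : ∀ t : ℤ, contrib f (θs j) (fun s => Y j (s + t) ω) 0 =
      contrib f (θs j) (fun s => Y j s ω) t := contrib_shift (θs j) fun s => Y j s ω
  simp only [hshift] at hn
  rw [← mul_div_assoc, ← mul_div_assoc, ← sub_div, ← sub_div] at hn
  have hn' := (div_pos_iff_of_pos_right hn0').1 hn
  change 0 < ∑ t ∈ trueSegment τ n j, contrib f (θs j) (fun s => Y j s ω) t
    - ∑ t ∈ trueSegment τ n j, (ψ fun s => Y j (s + t) ω) - _ at hn'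
  linarith

end Observations

end PQMLE

theorem proposition2p1 {Ω : Type*} [MeasurableSpace Ω] (μ : Measure Ω) [IsProbabilityMeasure μ]
    {d K : ℕ} (Θ : Set (PQMLE.Param d)) (hΘ : IsCompact Θ)
    (f : (ℕ → ℕ) → PQMLE.Param d → ℝ)
    (hf_meas : ∀ θ ∈ Θ, Measurable fun y => f y θ) (hf_nonneg : ∀ y, ∀ θ ∈ Θ, 0 ≤ f y θ)
    (τ : Fin (K + 1) → ℝ) (hτ : StrictMono τ) (hτ0 : τ 0 = 0) (hτ1 : τ (Fin.last K) = 1)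
    (θstar : Fin K → PQMLE.Param d) (hθstar : ∀ j, θstar j ∈ Θ)
    (Y : Fin K → ℤ → Ω → ℕ) (hY : ∀ j, PQMLE.IsRegime μ f (θstar j) (Y j))
    (hLip : PQMLE.LipschitzA0 f Θ)
    (hA0 : PQMLE.CondA0 μ f Θ Y)
    (hA1 : ∀ j, θstar j ∈ interior Θ)
    (hA2 : PQMLE.CondA2 μ f Θ τ Y) :
    (∀ (n : ℕ) (j : Fin K) (ω : Ω),
      (PQMLE.argmaxQL f Θ (PQMLE.observed τ Y n) (PQMLE.trueSegment τ n j) ω).Nonempty) ∧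
    ∀ (j : Fin K) (θhat : ℕ → Ω → PQMLE.Param d),
      (∀ n : ℕ, ∀ᵐ ω ∂μ,
        θhat n ω ∈ PQMLE.argmaxQL f Θ (PQMLE.observed τ Y n) (PQMLE.trueSegment τ n j) ω) →
      ∀ᵐ ω ∂μ, Tendsto (fun n => θhat n ω) atTop (𝓝 (θstar j)) := by
  open PQMLE in
  obtain ⟨hcont, α, h0, hα, -, hL⟩ := hLip
  obtain ⟨hid, c, hc, hfc⟩ := hA0
  have hpos : ∀ y, ∀ θ ∈ Θ, 0 < f y θ := fun y θ hθ => hc.trans_le (hfc y θ hθ)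
  refine ⟨fun n j ω => argmaxQL_nonempty hΘ ⟨_, hθstar j⟩ hcont hpos _ _ ω, ?_⟩
  intro j θhat hmax
  have hYj := hY j
  have hS := hYj.ergodic
  have hQ := hYj.lintegral_sq_ne_top
  have : IsProbabilityMeasure (pathLaw μ (Y j)) :=
    Measure.isProbabilityMeasure_map hYj.measurable_path.aemeasurable
  obtain ⟨G, hG, hfG⟩ := exists_envelope hS.toMeasurePreserving hQ hΘ hcont h0 hα hL hc hfc
  have hci : ∀ θ ∈ Θ, Integrable (fun x => contrib f θ x 0) (pathLaw μ (Y j)) := fun θ hθ =>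
    hG.mono' (measurable_contrib (hf_meas θ hθ)).aestronglyMeasurable
      (hfG.mono fun x hx => (hx θ hθ).1)
  have hfi : ∀ θ ∈ Θ, Integrable (fun x => f (lags x 0) θ) (pathLaw μ (Y j)) := fun θ hθ =>
    hG.mono' ((hf_meas θ hθ).comp (measurable_lags 0)).aestronglyMeasurable
      (hfG.mono fun x hx => (hx θ hθ).2)
  have hYi : Integrable (fun ω => (Y j 0 ω : ℝ)) μ := by
    refine (hYj.integrable_path_comp (integrable_path_sq hQ)).mono'
      ((measurable_of_countable (fun k : ℕ => (k : ℝ))).comp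
        (hYj.measurable 0)).aestronglyMeasurable (Eventually.of_forall fun ω => ?_)
    rw [Real.norm_eq_abs, Nat.abs_cast]
    exact_mod_cast Nat.le_self_pow two_ne_zero (Y j 0 ω)
  have hlt : ∀ θ ∈ Θ, θ ≠ θstar j → ∫ x, contrib f θ x 0 ∂(pathLaw μ (Y j)) <
      ∫ x, contrib f (θstar j) x 0 ∂(pathLaw μ (Y j)) := by
    intro θ hθ hne
    have hm := hYj.measurable_path.aemeasurable (μ := μ)
    rw [integral_map hm (hci θ hθ).aestronglyMeasurable,
      integral_map hm (hci _ (hθstar j)).aestronglyMeasurable]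
    exact integral_contrib_lt hYj (hf_meas θ hθ) (hf_meas _ (hθstar j)) (fun y => hpos y θ hθ)
      (fun y => hpos y _ (hθstar j)) hYi (hYj.integrable_path_comp (hci θ hθ))
      (hYj.integrable_path_comp (hci _ (hθstar j))) (hYj.integrable_path_comp (hfi θ hθ))
      (hYj.integrable_path_comp (hfi _ (hθstar j)))
      fun h => hne (hid j θ hθ _ (hθstar j) ⟨0, h⟩)
  -- By compactness, almost surely there is eventually no maximizer at a distance of at least `ε`.
  have hfar : ∀ ε > 0, ∀ᵐ ω ∂μ, ∀ᶠ n : ℕ in atTop, ∀ θ ∈ Θ \ Metric.ball (θstar j) ε,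
      θ ∉ argmaxQL f Θ (observed τ Y n) (trueSegment τ n j) ω := by
    intro ε hε
    refine (hΘ.diff Metric.isOpen_ball).induction_on
      (p := fun A => ∀ᵐ ω ∂μ, ∀ᶠ n : ℕ in atTop, ∀ θ ∈ A,
        θ ∉ argmaxQL f Θ (observed τ Y n) (trueSegment τ n j) ω) ?_ ?_ ?_ ?_
    · simp
    · intro A B hAB hB
      filter_upwards [hB] with ω hω
      filter_upwards [hω] with n hn θ hθ using hn θ (hAB hθ)
    · intro A B hA hB
      filter_upwards [hA, hB] with ω h1 h2
      filter_upwards [h1, h2] with n hn1 hn2 θ hθ using hθ.elim (hn1 θ) (hn2 θ)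
    · rintro θ₀ ⟨hθ₀, hball⟩
      have hne : θ₀ ≠ θstar j := by
        rintro rfl
        exact hball (Metric.mem_ball_self hε)
      obtain ⟨r, hr, hae⟩ := ae_eventually_not_mem_argmaxQL hY hΘ hcont hf_meas h0 hα hL hc hfc hτ
        hτ0 j (hθstar j) hθ₀ (hlt θ₀ hθ₀ hne) hG (hfG.mono fun x hx θ hθ => (hx θ hθ).1)
      exact ⟨Metric.ball θ₀ r, mem_nhdsWithin_of_mem_nhds (Metric.ball_mem_nhds _ hr), hae⟩
  filter_upwards [ae_all_iff.2 hmax, ae_all_iff.2 fun m : ℕ =>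
    hfar (1 / ((m : ℝ) + 1)) (by positivity)] with ω h1 h2
  rw [Metric.tendsto_nhds]
  intro ε hε
  obtain ⟨m, hm⟩ := exists_nat_one_div_lt hε
  filter_upwards [h2 m] with n hn
  by_contra hcon
  refine hn _ ⟨(h1 n).1, fun hb => hcon ?_⟩ (h1 n)
  exact (Metric.mem_ball.1 hb).trans hm
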